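/- Graphs are finite multigraphs. For a graph $G$ assign a variable $t_e$ to each edge $e$ and put $$\Psi_G=\sum_{T}\prod_{e\notin T}t_e\in\mathbb{Q}[t_e : e\in E(G)],$$ where $T$ runs over the spanning trees of $G$ (so $\Psi_G=0$ if $G$ is disconnected). *Condition 1* holds for an edge $e$ of a connected graph $G$ if $\Psi_G$ lies in the ideal generated by the partial derivatives of $\Psi_{G\smallsetminus e}$. A *source-terminal graph* is a graph with two distinct marked vertices $s,t$; for such a graph let $\Phi_G$ be the Kirchhoff polynomial $\Psi$ of the graph obtained from $G$ by identifying $s$ and $t$. The *parallel join* $G\star H$ is the disjoint union of $G$ and $H$ with the two sources identified and the two terminals identified. The *series join* of $G$ and $H$ is their disjoint union with the terminal of $G$ identified with the source of $H$; its source is that of $G$ and its terminal that of $H$. *Series-parallel graphs* are the source-terminal graphs obtained (up to isomorphism) from $K_2$, whose two vertices are the source and the terminal, by repeated parallel and series joins. *Simultaneous combination* $S(G,e)$ holds for a source-terminal graph $G$ and an edge $e$ if there are polynomials $A_j$ ($j\in E(G)\smallsetminus\{e\}$), $B$, $C$ over $\mathbb{Q}$ in the edge variables of $G$ such that $$\Psi_G=\sum_j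 A_j\,\partial_j\partial_e\Psi_G+B\,\partial_e\Psi_G,\qquad \Phi_G=\sum_j A_j\,\partial_j\partial_e\Phi_G+C\,\partial_e\Phi_G .$$ **Proposition.** Let $H$ be a series-parallel graph, let $u\neq v$ be vertices of $H$, and let $\Gamma$ be a source-terminal graph. Let $G$ be the graph obtained from the disjoint union of $H$ and the series join of $\Gamma$ with a single edge $e$ by identifying the source of this series join with $u$ and its terminal with $v$; the source and terminal of $G$ are those of $H$. Suppose that $G$ is series-parallel. If condition 1 holds for the edge $e$ of $G$ in the parallel join $G\star H$ of $G$ with a further disjoint copy of $H$, then $S(G,e)$ holds. -/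

import Mathlib

open scoped Graph

universe u v u' v'

/-! ### Kirchhoff polynomials of multigraphs -/

namespace Graph

variable {α : Type u} {β : Type v} {α' : Type u'} {β' : Type v'}

/-- The edge set `T` is a spanning tree of the multigraph `G`: the subgraph with all the vertices of
`G` and with edge set `T` has no loops and no multiple edges, and it is a tree. -/
def IsSpanningTree (G : Graph α β) (T : Set β) : Prop :=
  T ⊆ E(G) ∧ (G.restrict T).Simple ∧ (G.restrict T).toSimpleGraph.IsTree

open Classical in
/-- The Kirchhoff polynomial `Ψ_G = ∑_T ∏_{e ∉ T} t_e` over `ℚ`, where `T` runs through the spanning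
trees of `G` and `e` through the edges of `G`. It is `0` if `G` is disconnected. All graphs with
edges in `β` share the polynomial ring `ℚ[t_e : e ∈ β]`. -/
noncomputable def kirchhoff [Fintype β] (G : Graph α β) : MvPolynomial β ℚ :=
  ∑ T ∈ Finset.univ.filter (fun T : Finset β => G.IsSpanningTree (T : Set β)),
    ∏ e ∈ Finset.univ.filter (fun e : β => e ∈ E(G) ∧ e ∉ T), MvPolynomial.X e

/-- Condition 1 for the edge `e` of `G`: the polynomial `Ψ_G` lies in the ideal generated by the
partial derivatives of the Kirchhoff polynomial of `G` with `e` deleted. -/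
def ConditionOne [Fintype β] (G : Graph α β) (e : β) : Prop :=
  G.kirchhoff ∈
    Ideal.span (Set.range fun j : β => MvPolynomial.pderiv j (G.deleteEdges {e}).kirchhoff)

open Classical in
/-- The graph `G` with the vertices `x` and `y` identified. -/
noncomputable def identify (G : Graph α β) (x y : α) : Graph α β :=
  G.map fun w => if w = y then x else w

/-- The disjoint union of two multigraphs. -/
def disjointUnion (G : Graph α β) (G' : Graph α' β') : Graph (α ⊕ α') (β ⊕ β') where
  vertexSet := Sum.inl '' V(G) ∪ Sum.inr '' V(G')
  edgeSet := Sum.inl '' E(G) ∪ Sum.inr '' E(G')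
  IsLink e x y :=
    (∃ f a b, e = Sum.inl f ∧ x = Sum.inl a ∧ y = Sum.inl b ∧ G.IsLink f a b) ∨
      (∃ f a b, e = Sum.inr f ∧ x = Sum.inr a ∧ y = Sum.inr b ∧ G'.IsLink f a b)
  isLink_symm := by
    intro e _
    constructor
    rintro x y (⟨f, a, b, rfl, rfl, rfl, h⟩ | ⟨f, a, b, rfl, rfl, rfl, h⟩)
    · exact Or.inl ⟨f, b, a, rfl, rfl, rfl, h.symm⟩
    · exact Or.inr ⟨f, b, a, rfl, rfl, rfl, h.symm⟩
  eq_or_eq_of_isLink_of_isLink := by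
    rintro e x y z w (⟨f, a, b, rfl, rfl, rfl, h⟩ | ⟨f, a, b, rfl, rfl, rfl, h⟩)
      (⟨f', a', b', hf, rfl, rfl, h'⟩ | ⟨f', a', b', hf, rfl, rfl, h'⟩)
    · cases hf
      simpa using h.left_eq_or_eq h'
    · cases hf
    · cases hf
    · cases hf
      simpa using h.left_eq_or_eq h'
  edge_mem_iff_exists_isLink := by
    intro e
    constructor
    · rintro (⟨f, hf, rfl⟩ | ⟨f, hf, rfl⟩)
      · obtain ⟨a, b, h⟩ := exists_isLink_of_mem_edgeSet hf
        exact ⟨_, _, Or.inl ⟨f, a, b, rfl, rfl, rfl, h⟩⟩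
      · obtain ⟨a, b, h⟩ := exists_isLink_of_mem_edgeSet hf
        exact ⟨_, _, Or.inr ⟨f, a, b, rfl, rfl, rfl, h⟩⟩
    · rintro ⟨x, y, ⟨f, a, b, rfl, rfl, rfl, h⟩ | ⟨f, a, b, rfl, rfl, rfl, h⟩⟩
      · exact Or.inl ⟨f, h.edge_mem, rfl⟩
      · exact Or.inr ⟨f, h.edge_mem, rfl⟩
  left_mem_of_isLink := by
    rintro e x y (⟨f, a, b, rfl, rfl, rfl, h⟩ | ⟨f, a, b, rfl, rfl, rfl, h⟩)
    · exact Or.inl ⟨a, h.left_mem, rfl⟩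
    · exact Or.inr ⟨a, h.left_mem, rfl⟩

end Graph

/-! ### Source-terminal graphs -/

/-- A source-terminal graph: a multigraph with two distinct marked vertices. -/
structure STGraph (α : Type u) (β : Type v) where
  graph : Graph α β
  source : α
  terminal : α
  source_mem : source ∈ V(graph)
  terminal_mem : terminal ∈ V(graph)
  source_ne_terminal : source ≠ terminal

namespace STGraph

variable {α : Type u} {β : Type v} {α' : Type u'} {β' : Type v'}

/-- The Kirchhoff polynomial `Ψ_G`. -/
noncomputable def kirchhoff [Fintype β] (G : STGraph α β) : MvPolynomial β ℚ :=
  G.graph.kirchhoff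

/-- The polynomial `Φ_G`: the Kirchhoff polynomial of `G` with source and terminal identified. -/
noncomputable def kirchhoffST [Fintype β] (G : STGraph α β) : MvPolynomial β ℚ :=
  (G.graph.identify G.source G.terminal).kirchhoff

/-- Simultaneous combination `S(G, e)`. Upper indices denote partial derivatives. The
summand for `j = e` and those for `j` outside of `E(G)` vanish, because `Ψ_G` and `Φ_G` are linear
in each edge variable and involve only variables of edges of `G`. -/
def SimultaneousCombination [Fintype β] (G : STGraph α β) (e : β) : Prop :=
  ∃ (A : β → MvPolynomial β ℚ) (B C : MvPolynomial β ℚ),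
    G.kirchhoff =
      ∑ j, A j * MvPolynomial.pderiv j (MvPolynomial.pderiv e G.kirchhoff)
        + B * MvPolynomial.pderiv e G.kirchhoff ∧
    G.kirchhoffST =
      ∑ j, A j * MvPolynomial.pderiv j (MvPolynomial.pderiv e G.kirchhoffST)
        + C * MvPolynomial.pderiv e G.kirchhoffST

open Classical in
/-- The vertex map that identifies the vertex `p` of the second graph with the vertex `x` of the
first one, and the vertex `q` of the second graph with the vertex `y` of the first one. -/
noncomputable def glueMap (x y : α) (p q : α') : α ⊕ α' → α ⊕ α'
  | Sum.inl a => Sum.inl a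
  | Sum.inr b => if b = p then Sum.inl x else if b = q then Sum.inl y else Sum.inr b

/-- Attach a disjoint copy of `P` to `G`: the source of `P` is identified with the vertex `x` of
`G`, and the terminal of `P` with the vertex `y` of `G`. The marked vertices are those of `G`. -/
noncomputable def attach (G : STGraph α β) (P : STGraph α' β') (x y : α) :
    STGraph (α ⊕ α') (β ⊕ β') where
  graph := (G.graph.disjointUnion P.graph).map (glueMap x y P.source P.terminal)
  source := Sum.inl G.source
  terminal := Sum.inl G.terminal
  source_mem := ⟨Sum.inl G.source, Or.inl ⟨_, G.source_mem, rfl⟩, rfl⟩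
  terminal_mem := ⟨Sum.inl G.terminal, Or.inl ⟨_, G.terminal_mem, rfl⟩, rfl⟩
  source_ne_terminal := fun h => G.source_ne_terminal (Sum.inl_injective h)

/-- The parallel join `G ⋆ P`: the disjoint union with the two sources identified and the two
terminals identified. -/
noncomputable def parallel (G : STGraph α β) (P : STGraph α' β') : STGraph (α ⊕ α') (β ⊕ β') :=
  G.attach P G.source G.terminal

open Classical in
/-- The series join: the disjoint union with the source of `P` identified with the terminal
of `G`. Its source is the source of `G`, its terminal is the terminal of `P`. -/
noncomputable def series (G : STGraph α β) (P : STGraph α' β') : STGraph (α ⊕ α') (β ⊕ β') where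
  graph := (G.graph.disjointUnion P.graph).identify (Sum.inl G.terminal) (Sum.inr P.source)
  source := Sum.inl G.source
  terminal := Sum.inr P.terminal
  source_mem := ⟨Sum.inl G.source, Or.inl ⟨_, G.source_mem, rfl⟩, by simp⟩
  terminal_mem := ⟨Sum.inr P.terminal, Or.inr ⟨_, P.terminal_mem, rfl⟩, by
    simp [P.source_ne_terminal.symm]⟩
  source_ne_terminal := by simp

/-- The graph `K₂` with its two vertices as source and terminal. -/
def K₂ : STGraph Bool Unit where
  graph := Graph.banana false true Set.univ
  source := false
  terminal := true
  source_mem := Or.inl rfl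
  terminal_mem := Or.inr rfl
  source_ne_terminal := by simp

/-- Isomorphism of source-terminal graphs. -/
def Isomorphic (G : STGraph α β) (G' : STGraph α' β') : Prop :=
  ∃ (f : V(G.graph) ≃ V(G'.graph)) (g : E(G.graph) ≃ E(G'.graph)),
    (∀ (e : E(G.graph)) (x y : V(G.graph)),
      G.graph.IsLink e x y ↔ G'.graph.IsLink (g e) (f x) (f y)) ∧
    f ⟨G.source, G.source_mem⟩ = ⟨G'.source, G'.source_mem⟩ ∧
    f ⟨G.terminal, G.terminal_mem⟩ = ⟨G'.terminal, G'.terminal_mem⟩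

/-- Series-parallel graphs: the smallest class of source-terminal graphs that contains `K₂` and is
closed under parallel joins, series joins and isomorphisms. -/
inductive IsSeriesParallel : ∀ {α : Type u} {β : Type v}, STGraph α β → Prop
  | single {α : Type u} {β : Type v} (G : STGraph α β) (h : G.Isomorphic K₂) :
      IsSeriesParallel G
  | parallel {α α' : Type u} {β β' : Type v} (G : STGraph α β) (G' : STGraph α' β')
      (h : IsSeriesParallel G) (h' : IsSeriesParallel G') : IsSeriesParallel (G.parallel G')
  | series {α α' : Type u} {β β' : Type v} (G : STGraph α β) (G' : STGraph α' β')
      (h : IsSeriesParallel G) (h' : IsSeriesParallel G') : IsSeriesParallel (G.series G')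
  | ofIso {α α' : Type u} {β β' : Type v} (G : STGraph α β) (G' : STGraph α' β')
      (h : IsSeriesParallel G) (hiso : G.Isomorphic G') : IsSeriesParallel G'

/-- The graph that consists of `H` (with its source and terminal), of `Γ` and of one more edge `e`,
where `Γ` followed by `e` is attached in series between the vertices `x` and `y` of `H`: the source
of `Γ` is `x`, and `e` joins the terminal of `Γ` to `y`. -/
noncomputable def insertEar (H : STGraph α β) (Γ : STGraph α' β') (x y : α) :
    STGraph (α ⊕ (α' ⊕ Bool)) (β ⊕ (β' ⊕ Unit)) :=
  H.attach (Γ.series K₂) x y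

/-- The edge `e` of `insertEar H Γ x y`. -/
def earEdge {β : Type v} {β' : Type v'} : β ⊕ (β' ⊕ Unit) :=
  Sum.inr (Sum.inr ())

end STGraph

open Relation MvPolynomial

/-! Write `P`, `Q` for Ψ and Φ of `H`, `g` for Ψ of `Γ`, and `S` for Φ of `Γ` in series with `e`.
Splitting spanning trees along the two attaching vertices gives Ψ_G = P S + Y g and Φ_G = Q S + Z g.
The variable of `e` occurs only in `S`, with coefficient `g`, so ∂_e Ψ_G = P g and ∂_e Φ_G = Q g.

The polynomial of the parallel join is K = Ψ_G Q' + Φ_G P', with primes for the copy of `H`.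
Deleting `e` is differentiating by its variable, so condition 1 writes K as a combination of the ∂_j
∂_e K. Identify the variables of the copy with those of `H`. Since `g` contains no variable of `H`,
a derivative in a copied variable becomes the derivative in the original one. With D = ∑ A_j ∂_j
this gives Q Ψ_G + P Φ_G = Q D(P g) + P D(Q g) (`exists_of_conditionOne`).

This single relation splits into the two required ones by coprimality (`exists_combination`). As D
is a derivation, g divides 2PQ(S − Dg); g and PQ have disjoint variables, so S = Dg + k g.
Cancelling g leaves Q(Pk + Y − DP) + P(Qk + Z − DQ) = 0, and P, Q are coprime because `H` is
series-parallel (`IsSeriesParallel.posRelPrime`). So P and Q divide the respective brackets, and the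
quotients are B and C.

The combinatorics is handled through minimal connecting edge sets: identifications of vertices
become a relation in `ConnectedBy`, and `treePoly_glue` yields all the join formulas. -/

/-! ### Generated equivalence relations -/

theorem Relation.EqvGen.map_rel {α α' : Type*} {ρ : α → α → Prop} {ρ' : α' → α' → Prop}
    (F : α → α') (h : ∀ u v, ρ u v → EqvGen ρ' (F u) (F v)) {a b : α} (hab : EqvGen ρ a b) :
    EqvGen ρ' (F a) (F b) := by
  induction hab with
  | rel _ _ h' => exact h _ _ h'
  | refl => exact .refl _
  | symm _ _ _ ih => exact ih.symm
  | trans _ _ _ _ _ ih ih' => exact ih.trans _ _ _ ih'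

theorem Relation.EqvGen.bind {α : Type*} {ρ ρ' : α → α → Prop}
    (h : ∀ u v, ρ u v → EqvGen ρ' u v) {a b : α} (hab : EqvGen ρ a b) : EqvGen ρ' a b :=
  hab.map_rel id h

theorem Relation.EqvGen.congr {α : Type*} {ρ : α → α → Prop} (F : α → Prop)
    (h : ∀ u v, ρ u v → (F u ↔ F v)) {a b : α} (hab : EqvGen ρ a b) : F a ↔ F b := by
  induction hab with
  | rel _ _ h' => exact h _ _ h'
  | refl => exact .rfl
  | symm _ _ _ ih => exact ih.symm
  | trans _ _ _ _ _ ih ih' => exact ih.trans ih'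

/-- The alternative `a = b` accounts for points outside the vertex set, where the generated
equivalence is still reflexive. -/
theorem Relation.EqvGen.eq_or_reachable {α : Type*} {ρ : α → α → Prop} {V : Set α}
    {Q : SimpleGraph V}
    (h : ∀ a b, ρ a b → ∃ (ha : a ∈ V) (hb : b ∈ V), Q.Reachable ⟨a, ha⟩ ⟨b, hb⟩) {a b : α}
    (hab : EqvGen ρ a b) : a = b ∨ ∃ (ha : a ∈ V) (hb : b ∈ V), Q.Reachable ⟨a, ha⟩ ⟨b, hb⟩ := by
  induction hab with
  | rel a b h' => exact .inr (h a b h')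
  | refl => exact .inl rfl
  | symm _ _ _ ih =>
    obtain rfl | ⟨ha, hb, ih⟩ := ih
    · exact .inl rfl
    · exact .inr ⟨hb, ha, ih.symm⟩
  | trans _ _ _ _ _ ih ih' =>
    obtain rfl | ⟨ha, hb, ih⟩ := ih
    · exact ih'
    obtain rfl | ⟨hb', hc, ih'⟩ := ih'
    · exact .inr ⟨ha, hb, ih⟩
    · exact .inr ⟨ha, hc, ih.trans ih'⟩

theorem Relation.EqvGen.rel_right_iff {α : Type*} {ρ : α → α → Prop} {c u v : α} (h : ρ u v) :
    EqvGen ρ c u ↔ EqvGen ρ c v :=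
  ⟨fun h' => h'.trans _ _ _ (.rel _ _ h), fun h' => h'.trans _ _ _ (.symm _ _ (.rel _ _ h))⟩

/-- The relation that holds for the pair `(x, y)` only. -/
def pairRel {α : Type*} (x y : α) : α → α → Prop := fun u v => u = x ∧ v = y

/-- If two points become equivalent by adding the pair `(a, b)`, then each of them was equivalent
to one of `a`, `b`. -/
theorem Relation.EqvGen.of_sup_pairRel {α : Type*} {ρ : α → α → Prop} {a b x y : α}
    (h : EqvGen (ρ ⊔ pairRel a b) x y) (hn : ¬ EqvGen ρ x y) :
    (EqvGen ρ x a ∧ EqvGen ρ y b) ∨ (EqvGen ρ x b ∧ EqvGen ρ y a) := by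
  have key : ∀ a b : α, EqvGen (ρ ⊔ pairRel a b) x y → EqvGen ρ x a → EqvGen ρ y b := by
    intro a b h hxa
    -- The points equivalent to `x` or to `b` form a set closed under the enlarged relation, since
    -- it contains both `a` and `b`; so it contains `y`.
    have := (h.congr (fun w => EqvGen ρ x w ∨ EqvGen ρ b w) (by
      rintro u v (huv | ⟨rfl, rfl⟩)
      · exact or_congr (EqvGen.rel_right_iff huv) (EqvGen.rel_right_iff huv)
      · exact ⟨fun _ => .inr (.refl _), fun _ => .inl hxa⟩)).1 (.inl (.refl _))
    exact (this.resolve_left hn).symm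
  by_cases hxa : EqvGen ρ x a
  · exact .inl ⟨hxa, key a b h hxa⟩
  by_cases hxb : EqvGen ρ x b
  · refine .inr ⟨hxb, key b a (h.bind ?_) hxb⟩
    rintro u v (huv | ⟨rfl, rfl⟩)
    · exact .rel _ _ (.inl huv)
    · exact .symm _ _ (.rel _ _ (.inr ⟨rfl, rfl⟩))
  exfalso
  -- The class of `x` contains neither `a` nor `b`, so the new pair does not enlarge it.
  refine hn ((h.congr (fun w => EqvGen ρ x w) ?_).1 (.refl _))
  rintro u v (huv | ⟨rfl, rfl⟩)
  · exact EqvGen.rel_right_iff huv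
  · exact iff_of_false hxa hxb

/-! ### Spanning trees as minimal connecting edge sets -/

namespace Graph

variable {α : Type u} {β : Type v} {α' : Type u'} {β' : Type v'}

/-- The relation on vertices generating connectedness by the edges in `T`, after the pairs in the
relation `r` have been identified. -/
def linkRel (G : Graph α β) (r : α → α → Prop) (T : Finset β) : α → α → Prop :=
  fun u v => r u v ∨ ∃ e ∈ T, G.IsLink e u v

/-- The edges in `T` connect all vertices of `G`, after the pairs in the relation `r` have been
identified. -/
def ConnectedBy (G : Graph α β) (r : α → α → Prop) (T : Finset β) : Prop :=
  V(G).Nonempty ∧ ∀ a ∈ V(G), ∀ b ∈ V(G), EqvGen (G.linkRel r T) a b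

variable {G : Graph α β} {r r' : α → α → Prop} {T : Finset β}

theorem linkRel_mono (h : r ≤ r') : G.linkRel r T ≤ G.linkRel r' T :=
  fun _ _ => Or.imp_left (h _ _)

theorem linkRel_mono_right {T' : Finset β} (h : T ⊆ T') : G.linkRel r T ≤ G.linkRel r T' :=
  fun _ _ => Or.imp_right fun ⟨e, he, h'⟩ => ⟨e, h he, h'⟩

theorem ConnectedBy.bind {G' : Graph α β'} {T' : Finset β'} (h : G.ConnectedBy r T)
    (hV : V(G') = V(G))
    (h' : ∀ u v, G.linkRel r T u v → EqvGen (G'.linkRel r' T') u v) : G'.ConnectedBy r' T' :=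
  ⟨hV ▸ h.1, hV ▸ fun a ha b hb => (h.2 a ha b hb).bind h'⟩

theorem ConnectedBy.mono (h : G.ConnectedBy r T) (hr : r ≤ r') : G.ConnectedBy r' T :=
  h.bind rfl fun _ _ h => .rel _ _ (linkRel_mono hr _ _ h)

open Classical in
theorem eqvGen_linkRel_of_erase {e : β} {u v : α} (huv : G.IsLink e u v)
    (h : EqvGen (G.linkRel r (T.erase e)) u v) {a b : α} (hab : G.linkRel r T a b) :
    EqvGen (G.linkRel r (T.erase e)) a b := by
  obtain hab | ⟨f, hf, hab⟩ := hab
  · exact .rel _ _ (.inl hab)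
  obtain rfl | hne := eq_or_ne f e
  · obtain ⟨rfl, rfl⟩ | ⟨rfl, rfl⟩ := hab.eq_and_eq_or_eq_and_eq huv
    · exact h
    · exact h.symm
  · exact .rel _ _ (.inr ⟨f, Finset.mem_erase.2 ⟨hne, hf⟩, hab⟩)

/-- If `T` connects `G` and `s ≠ t`, then an edge of `T` becomes dispensable when `s` and `t` are
identified. -/
theorem ConnectedBy.exists_erase [DecidableEq β] (h : G.ConnectedBy r T) {s t : α} (hs : s ∈ V(G))
    (ht : t ∈ V(G)) (hst : ¬ EqvGen r s t) :
    ∃ e ∈ T, G.ConnectedBy (r ⊔ pairRel s t) (T.erase e) := by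
  obtain ⟨T₀, hT₀, hmin⟩ := exists_minimal_le_of_wellFoundedLT
    (fun S : Finset β => EqvGen (G.linkRel r S) s t) T (h.2 s hs t ht)
  -- Labels outside `E(G)` create no links, and `r` alone does not join `s` to `t`; so the minimal
  -- set `T₀` contains a genuine edge.
  have hne : ¬ ∀ e ∈ T₀, e ∉ E(G) := by
    intro hE
    refine hst (hmin.prop.bind ?_)
    rintro u v (huv | ⟨e, he, huv⟩)
    · exact .rel _ _ huv
    · exact absurd huv.edge_mem (hE e he)
  push Not at hne
  obtain ⟨e, heT, heE⟩ := hne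
  obtain ⟨a, b, hab⟩ := exists_isLink_of_mem_edgeSet heE
  have hn : ¬ EqvGen (G.linkRel r (T₀.erase e)) s t := fun h' =>
    (Finset.erase_ssubset heT).not_ge (hmin.2 h' (Finset.erase_subset _ _))
  have h1 : EqvGen (G.linkRel r (T₀.erase e) ⊔ pairRel a b) s t := by
    refine hmin.prop.bind ?_
    rintro u v (huv | ⟨f, hf, huv⟩)
    · exact .rel _ _ (.inl (.inl huv))
    obtain rfl | hfe := eq_or_ne f e
    · obtain ⟨rfl, rfl⟩ | ⟨rfl, rfl⟩ := huv.eq_and_eq_or_eq_and_eq hab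
      · exact .rel _ _ (.inr ⟨rfl, rfl⟩)
      · exact .symm _ _ (.rel _ _ (.inr ⟨rfl, rfl⟩))
    · exact .rel _ _ (.inl (.inr ⟨f, Finset.mem_erase.2 ⟨hfe, hf⟩, huv⟩))
  have hle : ∀ {x y}, EqvGen (G.linkRel r (T₀.erase e)) x y →
      EqvGen (G.linkRel (r ⊔ pairRel s t) (T.erase e)) x y := fun h' =>
    h'.mono (fun x y h' => linkRel_mono le_sup_left _ _
      (linkRel_mono_right (Finset.erase_subset_erase _ hT₀) _ _ h'))
  have hst' : EqvGen (G.linkRel (r ⊔ pairRel s t) (T.erase e)) s t :=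
    .rel _ _ (.inl (.inr ⟨rfl, rfl⟩))
  -- Without `e`, one end of `e` still hangs on `s` and the other on `t`. Identifying `s` and `t`
  -- therefore joins the ends of `e` again.
  have hab' : EqvGen (G.linkRel (r ⊔ pairRel s t) (T.erase e)) a b := by
    obtain ⟨h2, h3⟩ | ⟨h2, h3⟩ := h1.of_sup_pairRel hn
    · exact ((hle h2).symm.trans _ _ _ hst').trans _ _ _ (hle h3)
    · exact ((hle h3).symm.trans _ _ _ hst'.symm).trans _ _ _ (hle h2)
  refine ⟨e, hT₀ heT, (h.mono (r' := r ⊔ pairRel s t) le_sup_left).bind rfl fun u v huv => ?_⟩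
  convert eqvGen_linkRel_of_erase hab (by convert hab') huv

/-- `T` has the property `P`, but no set that arises by removing one element from `T` does. -/
def _root_.Finset.IsMin {β : Type*} [DecidableEq β] (P : Finset β → Prop) (T : Finset β) : Prop :=
  P T ∧ ∀ e ∈ T, ¬ P (T.erase e)

/-- A connected graph is a tree when every edge is a bridge, which is minimality under removal of
single edges. Minimality also excludes loops and parallel edges. -/
theorem isSpanningTree_iff [DecidableEq β] :
    G.IsSpanningTree (T : Set β) ↔ (T : Set β) ⊆ E(G) ∧ Finset.IsMin (G.ConnectedBy ⊥) T := by
  refine and_congr_right fun hTE => ⟨?_, ?_⟩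
  · rintro ⟨hs, ht⟩
    refine ⟨⟨?_, ?_⟩, ?_⟩
    · obtain ⟨a, ha⟩ := ht.connected.nonempty
      exact ⟨a, ha⟩
    · intro a ha b hb
      obtain ⟨w⟩ := ht.connected.preconnected ⟨a, ha⟩ ⟨b, hb⟩
      have : ∀ x y : V(G.restrict T), (G.restrict T).toSimpleGraph.Walk x y →
          EqvGen (G.linkRel ⊥ T) x.1 y.1 := by
        intro x y w
        induction w with
        | nil => exact .refl _
        | cons h _ ih =>
          obtain ⟨-, f, hf⟩ := h
          exact .trans _ _ _ (.rel _ _ (.inr ⟨f, hf.1, hf.2⟩)) ih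
      exact this _ _ w
    · intro e he hc
      obtain ⟨u, v, huv⟩ := exists_isLink_of_mem_edgeSet (hTE he)
      have huv' : (G.restrict T).IsLink e u v := ⟨he, huv⟩
      have hbr := SimpleGraph.isAcyclic_iff_forall_adj_isBridge.1 ht.isAcyclic
        (v := ⟨u, huv'.left_mem⟩) (w := ⟨v, huv'.right_mem⟩)
        (by rw [toSimpleGraph_adj_iff]; exact ⟨e, huv'⟩)
      rw [SimpleGraph.isBridge_iff] at hbr
      apply hbr
      have : ∀ a b : α, EqvGen (G.linkRel ⊥ (T.erase e)) a b → a = b ∨ ∃ (ha : a ∈ V(G.restrict T))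
          (hb : b ∈ V(G.restrict T)), ((G.restrict T).toSimpleGraph.deleteEdges
            {s(⟨u, huv'.left_mem⟩, ⟨v, huv'.right_mem⟩)}).Reachable ⟨a, ha⟩ ⟨b, hb⟩ := by
        intro a b hab
        refine hab.eq_or_reachable fun a b h => ?_
        obtain h | ⟨f, hf, h⟩ := h
        · exact h.elim
        rw [Finset.mem_erase] at hf
        have h' : (G.restrict T).IsLink f a b := ⟨hf.2, h⟩
        refine ⟨h'.left_mem, h'.right_mem, SimpleGraph.Adj.reachable ?_⟩
        rw [SimpleGraph.deleteEdges_adj, toSimpleGraph_adj_iff]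
        -- By simplicity, deleting the adjacency of `u` and `v` removes no edge other than `e`.
        refine ⟨⟨f, h'⟩, fun hab => hf.1 ?_⟩
        simp only [Set.mem_singleton_iff, Sym2.eq_iff, Subtype.ext_iff] at hab
        obtain ⟨rfl, rfl⟩ | ⟨rfl, rfl⟩ := hab
        · exact h'.eq huv'
        · exact h'.symm.eq huv'
      obtain h | ⟨_, _, h⟩ := this u v (hc.2 _ huv.left_mem _ huv.right_mem)
      · exact absurd h huv'.ne
      · exact h
  · rintro ⟨hc, hmin⟩
    have herase : ∀ e ∈ T, ∀ u v, G.IsLink e u v → ¬ EqvGen (G.linkRel ⊥ (T.erase e)) u v :=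
      fun e he u v huv h => hmin e he (hc.bind rfl fun a b hab => by
        convert eqvGen_linkRel_of_erase huv (by convert h) hab)
    have hloop : (G.restrict T).Loopless := ⟨fun e x h => herase e h.1 x x h.2 (.refl _)⟩
    have hsimple : (G.restrict T).Simple := by
      refine ⟨fun e f x y he hf => by_contra fun hne => herase e he.1 x y he.2 ?_⟩
      exact .rel _ _ (.inr ⟨f, Finset.mem_erase.2 ⟨Ne.symm hne, hf.1⟩, hf.2⟩)
    refine ⟨hsimple, ?_, ?_⟩
    · rw [SimpleGraph.connected_iff]
      refine ⟨fun a b => ?_, ?_⟩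
      · have : ∀ a b : α, EqvGen (G.linkRel ⊥ T) a b → a = b ∨ ∃ (ha : a ∈ V(G.restrict T))
            (hb : b ∈ V(G.restrict T)), (G.restrict T).toSimpleGraph.Reachable ⟨a, ha⟩ ⟨b, hb⟩ := by
          intro a b hab
          refine hab.eq_or_reachable fun a b h => ?_
          obtain h | ⟨f, hf, h⟩ := h
          · exact h.elim
          have h' : (G.restrict T).IsLink f a b := ⟨hf, h⟩
          refine ⟨h'.left_mem, h'.right_mem, SimpleGraph.Adj.reachable ?_⟩
          rw [toSimpleGraph_adj_iff]
          exact ⟨f, h'⟩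
        obtain h | ⟨_, _, h⟩ := this a b (hc.2 _ a.2 _ b.2)
        · rw [Subtype.ext h]
        · exact h
      · exact hc.1.to_subtype
    · rw [SimpleGraph.isAcyclic_iff_forall_adj_isBridge]
      intro v w hvw
      rw [SimpleGraph.isBridge_iff]
      rintro ⟨p⟩
      rw [toSimpleGraph_adj_iff] at hvw
      obtain ⟨e, he⟩ := hvw
      have : ∀ x y : V(G.restrict T),
          ((G.restrict T).toSimpleGraph.deleteEdges {s(v, w)}).Walk x y →
          EqvGen (G.linkRel ⊥ (T.erase e)) x.1 y.1 := by
        intro x y p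
        induction p with
        | nil => exact .refl _
        | @cons a b _ h _ ih =>
          rw [SimpleGraph.deleteEdges_adj, toSimpleGraph_adj_iff] at h
          obtain ⟨⟨f, hf⟩, hab⟩ := h
          refine .trans _ _ _ (.rel _ _ (.inr ⟨f, Finset.mem_erase.2 ⟨?_, hf.1⟩, hf.2⟩)) ih
          rintro rfl
          apply hab
          simp only [Set.mem_singleton_iff, Sym2.eq_iff, Subtype.ext_iff]
          exact hf.eq_and_eq_or_eq_and_eq he
      exact herase e he.1 _ _ he.2 (this _ _ p)

end Graph

/-! ### Generating polynomials of minimal sets -/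

section TreePolynomial

open scoped Classical

variable {β : Type v} {β' : Type v'}

/-- The sum of the monomials `∏ e ∈ E \ T, X e` over all `T ⊆ E` that have the property `P`, but
lose it when any one element is removed. -/
noncomputable def treePoly (E : Finset β) (P : Finset β → Prop) : MvPolynomial β ℚ :=
  ∑ T ∈ E.powerset with Finset.IsMin P T, ∏ e ∈ E \ T, X e

theorem treePoly_congr {E : Finset β} {P Q : Finset β → Prop} (h : ∀ T ⊆ E, (P T ↔ Q T)) :
    treePoly E P = treePoly E Q := by
  refine Finset.sum_congr (Finset.filter_congr fun T hT => ?_) fun _ _ => rfl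
  rw [Finset.mem_powerset] at hT
  refine and_congr (h T hT) (forall₂_congr fun e _ => not_congr (h _ ?_))
  exact (Finset.erase_subset _ _).trans hT

theorem treePoly_eq_sum_ite (E : Finset β) (P : Finset β → Prop) :
    treePoly E P = ∑ T ∈ E.powerset, if Finset.IsMin P T then ∏ e ∈ E \ T, X e else 0 :=
  Finset.sum_filter _ _

theorem treePoly_singleton (e : β) (P : Finset β → Prop) :
    treePoly {e} P = if P ∅ then X e else if P {e} then 1 else 0 := by
  have h : ({e} : Finset β).powerset = {∅, {e}} := by
    ext T
    simp [Finset.subset_singleton_iff]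
  rw [treePoly_eq_sum_ite, h, Finset.sum_pair (Finset.singleton_ne_empty e).symm]
  by_cases h0 : P ∅ <;> by_cases h1 : P {e} <;> simp [Finset.IsMin, h0, h1]

theorem isMin_disjSum [d : DecidableEq (β ⊕ β')] {R : Finset (β ⊕ β') → Prop} {T : Finset β} {T' : Finset β'} :
    Finset.IsMin R (T.disjSum T') ↔ R (T.disjSum T') ∧
      (∀ e ∈ T, ¬ R ((T.erase e).disjSum T')) ∧ ∀ e ∈ T', ¬ R (T.disjSum (T'.erase e)) := by
  have h1 : ∀ e, (T.disjSum T').erase (Sum.inl e) = (T.erase e).disjSum T' := by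
    intro e; ext (a | a) <;> simp
  have h2 : ∀ e, (T.disjSum T').erase (Sum.inr e) = T.disjSum (T'.erase e) := by
    intro e; ext (a | a) <;> simp
  simp only [Finset.IsMin, Sum.forall, Finset.inl_mem_disjSum, Finset.inr_mem_disjSum, h1, h2]

theorem treePoly_disjSum (E : Finset β) (E' : Finset β') (R : Finset (β ⊕ β') → Prop) :
    treePoly (E.disjSum E') R = ∑ T ∈ E.powerset, ∑ T' ∈ E'.powerset,
      if R (T.disjSum T') ∧ (∀ e ∈ T, ¬ R ((T.erase e).disjSum T')) ∧
          ∀ e ∈ T', ¬ R (T.disjSum (T'.erase e)) then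
        rename Sum.inl (∏ e ∈ E \ T, X e) * rename Sum.inr (∏ e ∈ E' \ T', X e) else 0 := by
  rw [treePoly_eq_sum_ite, ← Finset.sum_product']
  refine Finset.sum_bij' (fun T _ => (T.toLeft, T.toRight)) (fun T _ => T.1.disjSum T.2)
    ?_ ?_ ?_ ?_ ?_
  · intro T hT
    simpa [Finset.subset_disjSum] using hT
  · intro T hT
    simpa [Finset.subset_disjSum] using hT
  · intro T _
    simp [Finset.toLeft_disjSum_toRight]
  · intro T _
    simp
  · intro T _
    have h := isMin_disjSum (d := fun a b => Classical.propDecidable (a = b)) (R := R)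
      (T := T.toLeft) (T' := T.toRight)
    simp only [Finset.toLeft_disjSum_toRight] at h ⊢
    rw [map_prod, map_prod]
    simp only [rename_X]
    rw [← Finset.prod_disjSum]
    refine if_congr h (Finset.prod_congr ?_ fun _ _ => rfl) rfl
    ext (a | a) <;> simp

theorem treePoly_disjSum_and (E : Finset β) (E' : Finset β') (P : Finset β → Prop)
    (P' : Finset β' → Prop) :
    treePoly (E.disjSum E') (fun T => P T.toLeft ∧ P' T.toRight) =
      rename Sum.inl (treePoly E P) * rename Sum.inr (treePoly E' P') := by
  rw [treePoly_disjSum, treePoly_eq_sum_ite, treePoly_eq_sum_ite, map_sum, map_sum,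
    Finset.sum_mul_sum]
  refine Finset.sum_congr rfl fun T _ => Finset.sum_congr rfl fun T' _ => ?_
  have : ((P T ∧ P' T') ∧ (∀ e ∈ T, ¬ (P (T.erase e) ∧ P' T')) ∧
      ∀ e ∈ T', ¬ (P T ∧ P' (T'.erase e))) ↔ Finset.IsMin P T ∧ Finset.IsMin P' T' := by
    simp only [Finset.IsMin]
    grind
  simp only [Finset.toLeft_disjSum, Finset.toRight_disjSum, this]
  split_ifs <;> simp_all

/-- A minimal set for the disjunction is minimal for `P` on one side and for the weaker `Q'` on the
other, or vice versa. The two cases exclude each other: a set with `P` can lose an element and keep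
`Q`, so it is never minimal for both. -/
theorem treePoly_disjSum_or (E : Finset β) (E' : Finset β') {P Q : Finset β → Prop}
    {P' Q' : Finset β' → Prop} (hPQ : ∀ T, P T → Q T) (hPQ' : ∀ T, P' T → Q' T)
    (hP : ∀ T, P T → ∃ e ∈ T, Q (T.erase e)) (hP' : ∀ T, P' T → ∃ e ∈ T, Q' (T.erase e)) :
    treePoly (E.disjSum E') (fun T => P T.toLeft ∧ Q' T.toRight ∨ Q T.toLeft ∧ P' T.toRight) =
      rename Sum.inl (treePoly E P) * rename Sum.inr (treePoly E' Q') +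
        rename Sum.inl (treePoly E Q) * rename Sum.inr (treePoly E' P') := by
  rw [treePoly_disjSum]
  simp only [treePoly_eq_sum_ite E, treePoly_eq_sum_ite E', map_sum]
  rw [Finset.sum_mul_sum, Finset.sum_mul_sum, ← Finset.sum_add_distrib]
  refine Finset.sum_congr rfl fun T _ => ?_
  rw [← Finset.sum_add_distrib]
  refine Finset.sum_congr rfl fun T' _ => ?_
  have h1 : ((P T ∧ Q' T' ∨ Q T ∧ P' T') ∧
      (∀ e ∈ T, ¬ (P (T.erase e) ∧ Q' T' ∨ Q (T.erase e) ∧ P' T')) ∧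
      ∀ e ∈ T', ¬ (P T ∧ Q' (T'.erase e) ∨ Q T ∧ P' (T'.erase e))) ↔
      (Finset.IsMin P T ∧ Finset.IsMin Q' T') ∨ (Finset.IsMin Q T ∧ Finset.IsMin P' T') := by
    simp only [Finset.IsMin]
    grind
  have h2 : ¬ (Finset.IsMin P T ∧ Finset.IsMin Q T) := by
    rintro ⟨h, h'⟩
    obtain ⟨e, he, hq⟩ := hP T h.1
    exact h'.2 e he hq
  simp only [Finset.toLeft_disjSum, Finset.toRight_disjSum, h1]
  by_cases hp : Finset.IsMin P T <;> by_cases hq : Finset.IsMin Q T <;>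
    by_cases hp' : Finset.IsMin P' T' <;> by_cases hq' : Finset.IsMin Q' T' <;> simp_all

theorem treePoly_map (E : Finset β) (j : β ↪ β') (P : Finset β' → Prop) :
    treePoly (E.map j) P = rename j (treePoly E fun T => P (T.map j)) := by
  rw [treePoly_eq_sum_ite, treePoly_eq_sum_ite, map_sum]
  refine (Finset.sum_bij (fun T _ => T.map j) ?_ ?_ ?_ ?_).symm
  · intro T hT
    simpa using hT
  · intro T _ T' _ h
    exact Finset.map_injective j h
  · intro T hT
    obtain ⟨S, hS, rfl⟩ := Finset.subset_map_iff.1 (Finset.mem_powerset.1 hT)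
    exact ⟨S, Finset.mem_powerset.2 hS, rfl⟩
  · intro T _
    have : Finset.IsMin P (T.map j) ↔ Finset.IsMin (fun T => P (T.map j)) T := by
      simp [Finset.IsMin, Finset.map_erase]
    simp only [this, apply_ite (rename j), map_zero, map_prod, rename_X, ← Finset.map_sdiff,
      Finset.prod_map]

theorem pderiv_prod_X (s : Finset β) (e : β) :
    pderiv e (∏ i ∈ s, X i : MvPolynomial β ℚ) = if e ∈ s then ∏ i ∈ s.erase e, X i else 0 := by
  split_ifs with h
  · rw [← Finset.mul_prod_erase s _ h, pderiv_mul, pderiv_X_self, one_mul, add_eq_left,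
      pderiv_eq_zero_of_notMem_vars, mul_zero]
    intro h'
    obtain ⟨i, hi, h'⟩ := Finset.mem_biUnion.1 (vars_prod _ h')
    rw [vars_X, Finset.mem_singleton] at h'
    exact (Finset.mem_erase.1 hi).1 h'.symm
  · refine pderiv_eq_zero_of_notMem_vars fun h' => h ?_
    obtain ⟨i, hi, h'⟩ := Finset.mem_biUnion.1 (vars_prod _ h')
    rw [vars_X, Finset.mem_singleton] at h'
    exact h' ▸ hi

/-- The variable of `e` divides exactly the monomials of the sets avoiding `e`; the others are
killed. -/
theorem pderiv_treePoly {E : Finset β} {e : β} (he : e ∈ E) (P : Finset β → Prop) :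
    pderiv e (treePoly E P) = treePoly (E.erase e) P := by
  rw [treePoly, map_sum]
  simp only [pderiv_prod_X]
  rw [← Finset.sum_filter, treePoly]
  refine Finset.sum_congr ?_ fun T _ => ?_
  · ext T
    simp only [Finset.mem_filter, Finset.mem_powerset, Finset.mem_sdiff, he, true_and,
      Finset.subset_erase]
    tauto
  · refine Finset.prod_congr ?_ fun _ _ => rfl
    ext a
    simp
    tauto

end TreePolynomial

/-! ### Coprimality and disjoint sets of variables -/

section Disjoint

variable {σ : Type*} {τ : Type*}

theorem pderiv_rename_eq_zero {f : σ → τ} {i : τ} (hi : i ∉ Set.range f) (p : MvPolynomial σ ℚ) :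
    pderiv i (rename f p) = 0 := by
  classical
  refine pderiv_eq_zero_of_notMem_vars fun h => hi ?_
  obtain ⟨a, _, ha⟩ := Finset.mem_image.1 (vars_rename f p h)
  exact ⟨a, ha⟩

/-- The degree in each variable is additive on nonzero products. -/
theorem vars_subset_of_dvd {p d : MvPolynomial σ ℚ} (hp : p ≠ 0) (h : d ∣ p) :
    d.vars ⊆ p.vars := by
  classical
  obtain ⟨c, rfl⟩ := h
  intro i hi
  rw [mem_vars_iff_degreeOf_ne_zero] at hi ⊢
  rw [degreeOf_mul_eq (left_ne_zero_of_mul hp) (right_ne_zero_of_mul hp)]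
  omega

theorem isUnit_of_vars_eq_empty {d : MvPolynomial σ ℚ} (hd : d ≠ 0) (h : d.vars = ∅) :
    IsUnit d := by
  rw [vars_eq_empty_iff_eq_C] at h
  rw [h] at hd ⊢
  exact (IsUnit.mk0 _ (by rintro h0; simp [h0] at hd)).map C

/-- Nonzero polynomials in disjoint sets of variables are relatively prime. -/
theorem isRelPrime_rename_rename {ι κ : Type*} {f : ι → σ} {g : κ → σ}
    (hfg : ∀ i k, f i ≠ g k) {p : MvPolynomial ι ℚ} {q : MvPolynomial κ ℚ}
    (hp : rename f p ≠ 0) (hq : rename g q ≠ 0) : IsRelPrime (rename f p) (rename g q) := by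
  classical
  intro d hd hd'
  refine isUnit_of_vars_eq_empty (ne_zero_of_dvd_ne_zero hp hd) ?_
  refine Finset.eq_empty_of_forall_notMem fun i hi => ?_
  obtain ⟨a, _, rfl⟩ := Finset.mem_image.1 (vars_rename f p (vars_subset_of_dvd hp hd hi))
  obtain ⟨b, _, hb⟩ := Finset.mem_image.1 (vars_rename g q (vars_subset_of_dvd hq hd' hi))
  exact hfg a b hb.symm

/-- As `p ≠ 0`, a common divisor after renaming uses only renamed variables and comes from the
smaller ring; `killCompl` pulls the divisibility back. -/
theorem isRelPrime_rename_iff {ι : Type*} {f : ι → σ} (hf : Function.Injective f)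
    {p q : MvPolynomial ι ℚ} (hp : p ≠ 0) :
    IsRelPrime (rename f p) (rename f q) ↔ IsRelPrime p q := by
  classical
  constructor
  · intro h d hd hd'
    have := (h (map_dvd (rename f) hd) (map_dvd (rename f) hd')).map (killCompl (R := ℚ) hf)
    rwa [killCompl_rename_app] at this
  · intro h d hd hd'
    have hp' : rename f p ≠ 0 := (map_ne_zero_iff _ (rename_injective f hf)).2 hp
    obtain ⟨d', rfl⟩ := exists_rename_eq_of_vars_subset_range d f hf (by
      intro i hi
      obtain ⟨a, _, ha⟩ := Finset.mem_image.1 (vars_rename f p (vars_subset_of_dvd hp' hd hi))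
      exact ⟨a, ha⟩)
    have h1 := map_dvd (killCompl (R := ℚ) hf) hd
    have h2 := map_dvd (killCompl (R := ℚ) hf) hd'
    rw [killCompl_rename_app, killCompl_rename_app] at h1 h2
    exact (h h1 h2).map (rename f)

end Disjoint

/-! ### Connectedness of glued graphs -/

namespace Graph

variable {α : Type u} {β : Type v} {α' : Type u'} {β' : Type v'}

/-- Trades an actual quotient of vertices for a relation: `f` moves each vertex within its
`r`-class, and `r'` records the identifications that `f` does not perform. -/
theorem connectedBy_map_iff {G : Graph α β} {f : α → α} {r r' : α → α → Prop} {T : Finset β}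
    (h₁ : ∀ w, EqvGen r w (f w)) (h₂ : ∀ u v, r' u v → EqvGen r u v)
    (h₃ : ∀ u v, r u v → EqvGen r' (f u) (f v)) :
    (G.map f).ConnectedBy r' T ↔ G.ConnectedBy r T := by
  have hle : ∀ {u v}, EqvGen r u v → EqvGen (G.linkRel r T) u v := fun h =>
    h.mono fun _ _ h => .inl h
  have hle' : ∀ {u v}, EqvGen r' u v → EqvGen ((G.map f).linkRel r' T) u v := fun h =>
    h.mono fun _ _ h => .inl h
  constructor
  · rintro ⟨⟨_, a, ha, rfl⟩, h⟩
    refine ⟨⟨a, ha⟩, fun a ha b hb => ?_⟩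
    refine ((hle (h₁ a)).trans _ _ _ ?_).trans _ _ _ (hle (h₁ b)).symm
    refine (h _ ⟨a, ha, rfl⟩ _ ⟨b, hb, rfl⟩).bind ?_
    rintro u v (huv | ⟨e, he, u, v, huv, rfl, rfl⟩)
    · exact hle (h₂ _ _ huv)
    · exact ((hle (h₁ u)).symm.trans _ _ _ (.rel _ _ (.inr ⟨e, he, huv⟩))).trans _ _ _
        (hle (h₁ v))
  · rintro ⟨⟨a, ha⟩, h⟩
    refine ⟨⟨f a, a, ha, rfl⟩, ?_⟩
    rintro _ ⟨a, ha, rfl⟩ _ ⟨b, hb, rfl⟩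
    refine (h a ha b hb).map_rel f ?_
    rintro u v (huv | ⟨e, he, huv⟩)
    · exact hle' (h₃ _ _ huv)
    · exact .rel _ _ (.inr ⟨e, he, u, v, huv, rfl, rfl⟩)

theorem connectedBy_identify_iff {G : Graph α β} {x y : α} {T : Finset β} :
    (G.identify x y).ConnectedBy ⊥ T ↔ G.ConnectedBy (pairRel x y) T := by
  classical
  refine connectedBy_map_iff (fun w => ?_) (fun _ _ h => h.elim) ?_
  · split_ifs with h
    · exact h ▸ .symm _ _ (.rel _ _ ⟨rfl, rfl⟩)
    · exact .refl _
  · rintro u v ⟨rfl, rfl⟩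
    simp only [if_true, ite_self]
    exact .refl _

/-- The relation on a disjoint union given by `r` on the left part and by the pair `(x, p)`. -/
def glueRel (r : α → α → Prop) (x : α) (p : α') : α ⊕ α' → α ⊕ α' → Prop :=
  Relation.Map r Sum.inl Sum.inl ⊔ pairRel (Sum.inl x) (Sum.inr p)

variable {G : Graph α β} {G' : Graph α' β'} {r : α → α → Prop} {x y : α} {p q : α'}
  {T : Finset (β ⊕ β')}

theorem eqvGen_inl {ρ : α ⊕ α' → α ⊕ α' → Prop} (hρ : glueRel r x p ≤ ρ) {a b : α}
    (h : EqvGen (G.linkRel r T.toLeft) a b) :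
    EqvGen ((G.disjointUnion G').linkRel ρ T) (Sum.inl a) (Sum.inl b) := by
  refine h.map_rel Sum.inl ?_
  rintro u v (huv | ⟨e, he, huv⟩)
  · exact .rel _ _ (.inl (hρ _ _ (.inl ⟨u, v, huv, rfl, rfl⟩)))
  · exact .rel _ _ (.inr ⟨Sum.inl e, Finset.mem_toLeft.1 he,
      .inl ⟨e, u, v, rfl, rfl, rfl, huv⟩⟩)

theorem eqvGen_inr {ρ : α ⊕ α' → α ⊕ α' → Prop} {a b : α'}
    (h : EqvGen (G'.linkRel ⊥ T.toRight) a b) :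
    EqvGen ((G.disjointUnion G').linkRel ρ T) (Sum.inr a) (Sum.inr b) := by
  refine h.map_rel Sum.inr ?_
  rintro u v (huv | ⟨e, he, huv⟩)
  · exact huv.elim
  · exact .rel _ _ (.inr ⟨Sum.inr e, Finset.mem_toRight.1 he,
      .inr ⟨e, u, v, rfl, rfl, rfl, huv⟩⟩)

theorem connectedBy_disjointUnion_of {ρ : α ⊕ α' → α ⊕ α' → Prop}
    (hx : x ∈ V(G))
    (hρ : EqvGen ((G.disjointUnion G').linkRel ρ T) (Sum.inl x) (Sum.inr p))
    (h : ∀ a ∈ V(G), EqvGen ((G.disjointUnion G').linkRel ρ T) (Sum.inl x) (Sum.inl a))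
    (h' : ∀ a ∈ V(G'), EqvGen ((G.disjointUnion G').linkRel ρ T) (Sum.inr p) (Sum.inr a)) :
    (G.disjointUnion G').ConnectedBy ρ T := by
  have key : ∀ a ∈ V(G.disjointUnion G'),
      EqvGen ((G.disjointUnion G').linkRel ρ T) (Sum.inl x) a := by
    rintro _ (⟨a, ha, rfl⟩ | ⟨a, ha, rfl⟩)
    · exact h a ha
    · exact hρ.trans _ _ _ (h' a ha)
  exact ⟨⟨Sum.inl x, .inl ⟨x, hx, rfl⟩⟩, fun a ha b hb => (key a ha).symm.trans _ _ _ (key b hb)⟩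

/-- Collapsing the right part of a disjoint union. -/
theorem connectedBy_left {ρ : α ⊕ α' → α ⊕ α' → Prop} {s : α → α → Prop} (hx : x ∈ V(G))
    (hρ : ∀ u v, ρ u v → EqvGen s (Sum.elim id (fun _ => x) u) (Sum.elim id (fun _ => x) v))
    (h : (G.disjointUnion G').ConnectedBy ρ T) : G.ConnectedBy s T.toLeft := by
  refine ⟨⟨x, hx⟩, fun a ha b hb => ?_⟩
  refine (h.2 _ (.inl ⟨a, ha, rfl⟩) _ (.inl ⟨b, hb, rfl⟩)).map_rel (Sum.elim id fun _ => x) ?_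
  rintro u v (huv | ⟨e, he, ⟨f, a, b, rfl, rfl, rfl, hf⟩ | ⟨f, a, b, rfl, rfl, rfl, hf⟩⟩)
  · exact (hρ _ _ huv).mono fun _ _ h => .inl h
  · exact .rel _ _ (.inr ⟨f, Finset.mem_toLeft.2 he, hf⟩)
  · exact .refl _

/-- Collapsing the left part of a disjoint union. -/
theorem connectedBy_right {ρ : α ⊕ α' → α ⊕ α' → Prop} {s : α' → α' → Prop} (hp : p ∈ V(G'))
    (hρ : ∀ u v, ρ u v → EqvGen s (Sum.elim (fun _ => p) id u) (Sum.elim (fun _ => p) id v))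
    (h : (G.disjointUnion G').ConnectedBy ρ T) : G'.ConnectedBy s T.toRight := by
  refine ⟨⟨p, hp⟩, fun a ha b hb => ?_⟩
  refine (h.2 _ (.inr ⟨a, ha, rfl⟩) _ (.inr ⟨b, hb, rfl⟩)).map_rel (Sum.elim (fun _ => p) id) ?_
  rintro u v (huv | ⟨e, he, ⟨f, a, b, rfl, rfl, rfl, hf⟩ | ⟨f, a, b, rfl, rfl, rfl, hf⟩⟩)
  · exact (hρ _ _ huv).mono fun _ _ h => .inl h
  · exact .refl _
  · exact .rel _ _ (.inr ⟨f, Finset.mem_toRight.2 he, hf⟩)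

/-- Connectedness of a disjoint union with one pair of vertices identified. -/
theorem connectedBy_glueRel_iff (hx : x ∈ V(G)) (hp : p ∈ V(G')) :
    (G.disjointUnion G').ConnectedBy (glueRel r x p) T ↔
      G.ConnectedBy r T.toLeft ∧ G'.ConnectedBy ⊥ T.toRight := by
  refine ⟨fun h => ⟨connectedBy_left hx ?_ h, connectedBy_right hp ?_ h⟩, fun ⟨h, h'⟩ => ?_⟩
  · rintro _ _ (⟨u, v, huv, rfl, rfl⟩ | ⟨rfl, rfl⟩)
    · exact .rel _ _ huv
    · exact .refl _
  · rintro _ _ (⟨u, v, huv, rfl, rfl⟩ | ⟨rfl, rfl⟩) <;> exact .refl _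
  · exact connectedBy_disjointUnion_of hx (.rel _ _ (.inl (.inr ⟨rfl, rfl⟩)))
      (fun a ha => eqvGen_inl le_rfl (h.2 _ hx _ ha)) fun a ha => eqvGen_inr (h'.2 _ hp _ ha)

theorem ConnectedBy.sup_pairRel_iff {T : Finset β} (h : EqvGen (G.linkRel r T) x y) :
    G.ConnectedBy (r ⊔ pairRel x y) T ↔ G.ConnectedBy r T := by
  refine ⟨fun h' => h'.bind rfl ?_, fun h' => h'.mono le_sup_left⟩
  rintro u v ((huv | ⟨rfl, rfl⟩) | huv)
  · exact .rel _ _ (.inl huv)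
  · exact h
  · exact .rel _ _ (.inr huv)

/-- Connectedness of a disjoint union with two pairs of vertices identified. -/
theorem connectedBy_glueRel_sup_iff (hx : x ∈ V(G)) (hy : y ∈ V(G)) (hp : p ∈ V(G'))
    (hq : q ∈ V(G')) :
    (G.disjointUnion G').ConnectedBy (glueRel r x p ⊔ pairRel (Sum.inl y) (Sum.inr q)) T ↔
      G.ConnectedBy r T.toLeft ∧ G'.ConnectedBy (pairRel p q) T.toRight ∨
        G.ConnectedBy (r ⊔ pairRel x y) T.toLeft ∧ G'.ConnectedBy ⊥ T.toRight := by
  set ρ := glueRel r x p ⊔ pairRel (Sum.inl y) (Sum.inr q) with hρ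
  have hxp : EqvGen ((G.disjointUnion G').linkRel ρ T) (Sum.inl x) (Sum.inr p) :=
    .rel _ _ (.inl (.inl (.inr ⟨rfl, rfl⟩)))
  have hyq : EqvGen ((G.disjointUnion G').linkRel ρ T) (Sum.inl y) (Sum.inr q) :=
    .rel _ _ (.inl (.inr ⟨rfl, rfl⟩))
  constructor
  · intro h
    have h1 : G.ConnectedBy (r ⊔ pairRel x y) T.toLeft := by
      refine connectedBy_left hx ?_ h
      rintro _ _ ((⟨u, v, huv, rfl, rfl⟩ | ⟨rfl, rfl⟩) | ⟨rfl, rfl⟩)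
      · exact .rel _ _ (.inl huv)
      · exact .refl _
      · exact .symm _ _ (.rel _ _ (.inr ⟨rfl, rfl⟩))
    have h2 : G'.ConnectedBy (pairRel p q) T.toRight := by
      refine connectedBy_right hp ?_ h
      rintro _ _ ((⟨u, v, huv, rfl, rfl⟩ | ⟨rfl, rfl⟩) | ⟨rfl, rfl⟩)
      · exact .refl _
      · exact .refl _
      · exact .rel _ _ ⟨rfl, rfl⟩
    by_cases h3 : EqvGen (G.linkRel r T.toLeft) x y
    · exact .inl ⟨(ConnectedBy.sup_pairRel_iff h3).1 h1, h2⟩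
    by_cases h4 : EqvGen (G'.linkRel ⊥ T.toRight) p q
    · rw [← bot_sup_eq (pairRel p q), ConnectedBy.sup_pairRel_iff h4] at h2
      exact .inr ⟨h1, h2⟩
    exfalso
    apply h3
    -- If neither side joins its two attaching vertices, the points reached from `x` on the left and
    -- from `p` on the right form a closed set that misses `y`.
    refine ((h.2 _ (.inl ⟨x, hx, rfl⟩) _ (.inl ⟨y, hy, rfl⟩)).congr
      (Sum.elim (EqvGen (G.linkRel r T.toLeft) x) (EqvGen (G'.linkRel ⊥ T.toRight) p)) ?_).1
      (.refl _)
    rintro _ _ (((⟨u, v, huv, rfl, rfl⟩ | ⟨rfl, rfl⟩) | ⟨rfl, rfl⟩) |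
      ⟨e, he, ⟨f, a, b, rfl, rfl, rfl, hf⟩ | ⟨f, a, b, rfl, rfl, rfl, hf⟩⟩)
    · exact EqvGen.rel_right_iff (.inl huv)
    · exact iff_of_true (.refl _) (.refl _)
    · exact iff_of_false h3 h4
    · exact EqvGen.rel_right_iff (.inr ⟨f, Finset.mem_toLeft.2 he, hf⟩)
    · exact EqvGen.rel_right_iff (.inr ⟨f, Finset.mem_toRight.2 he, hf⟩)
  · rintro (⟨h, h'⟩ | ⟨h, h'⟩)
    · have hl : ∀ a ∈ V(G), EqvGen ((G.disjointUnion G').linkRel ρ T) (Sum.inl x) (Sum.inl a) :=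
        fun a ha => eqvGen_inl le_sup_left (h.2 _ hx _ ha)
      refine connectedBy_disjointUnion_of hx hxp hl fun a ha => ?_
      refine (h'.2 _ hp _ ha).map_rel Sum.inr ?_
      rintro u v (⟨rfl, rfl⟩ | ⟨e, he, huv⟩)
      · exact hxp.symm.trans _ _ _ ((hl _ hy).trans _ _ _ hyq)
      · exact eqvGen_inr (.rel _ _ (.inr ⟨e, he, huv⟩))
    · have hr : ∀ a ∈ V(G'), EqvGen ((G.disjointUnion G').linkRel ρ T) (Sum.inr p) (Sum.inr a) :=
        fun a ha => eqvGen_inr (h'.2 _ hp _ ha)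
      refine connectedBy_disjointUnion_of hx hxp (fun a ha => ?_) hr
      refine (h.2 _ hx _ ha).map_rel Sum.inl ?_
      rintro u v ((huv | ⟨rfl, rfl⟩) | huv)
      · exact eqvGen_inl le_sup_left (.rel _ _ (.inl huv))
      · exact hxp.trans _ _ _ ((hr _ hq).trans _ _ _ hyq.symm)
      · exact eqvGen_inl le_sup_left (.rel _ _ (.inr huv))

theorem kirchhoff_eq_treePoly [Fintype β] (G : Graph α β) {E : Finset β} (hE : (E : Set β) = E(G)) :
    G.kirchhoff = treePoly E (G.ConnectedBy ⊥) := by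
  classical
  rw [kirchhoff, treePoly]
  refine Finset.sum_congr ?_ fun T _ => Finset.prod_congr ?_ fun _ _ => rfl
  · ext T
    simp only [Finset.mem_filter, Finset.mem_univ, true_and, Finset.mem_powerset,
      isSpanningTree_iff, ← hE, Finset.coe_subset]
  · ext e
    simp [← hE]

theorem kirchhoff_identify_eq_treePoly [Fintype β] (G : Graph α β) {E : Finset β}
    (hE : (E : Set β) = E(G)) (x y : α) :
    (G.identify x y).kirchhoff = treePoly E (G.ConnectedBy (pairRel x y)) := by
  exact (kirchhoff_eq_treePoly (G.identify x y) hE).trans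
    (treePoly_congr fun _ _ => connectedBy_identify_iff)

/-- This turns condition 1 into membership in the ideal of the second derivatives ∂_j ∂_e. For a
bridge both sides are 0. -/
theorem kirchhoff_deleteEdges [Fintype β] (G : Graph α β) {e : β} (he : e ∈ E(G)) :
    (G.deleteEdges {e}).kirchhoff = pderiv e G.kirchhoff := by
  classical
  have hE : ((Finset.univ.filter (· ∈ E(G)) : Finset β) : Set β) = E(G) := by simp
  rw [kirchhoff_eq_treePoly G hE, pderiv_treePoly (by simpa using he),
    kirchhoff_eq_treePoly _ (E := (Finset.univ.filter (· ∈ E(G))).erase e)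
      (by simp [edgeSet_deleteEdges])]
  refine treePoly_congr fun T hT => ?_
  have heT : e ∉ T := fun h => Finset.notMem_erase _ _ (hT h)
  constructor
  · refine fun h => h.bind rfl ?_
    rintro u v (huv | ⟨f, hf, huv⟩)
    · exact huv.elim
    · exact .rel _ _ (.inr ⟨f, hf, huv.1⟩)
  · refine fun h => h.bind rfl ?_
    rintro u v (huv | ⟨f, hf, huv⟩)
    · exact huv.elim
    · exact .rel _ _ (.inr ⟨f, hf, huv, fun h => heT (Set.mem_singleton_iff.1 h ▸ hf)⟩)

end Graph

/-! ### Ψ and Φ of attachments, parallel and series joins -/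

namespace STGraph

open Graph

variable {α : Type u} {β : Type v} {α' : Type u'} {β' : Type v'}

theorem connectedBy_attach_iff (G : STGraph α β) (P : STGraph α' β') {x y : α}
    {r : α → α → Prop} {T : Finset (β ⊕ β')} :
    (G.attach P x y).graph.ConnectedBy (Relation.Map r Sum.inl Sum.inl) T ↔
      (G.graph.disjointUnion P.graph).ConnectedBy
        (glueRel r x P.source ⊔ pairRel (Sum.inl y) (Sum.inr P.terminal)) T := by
  refine connectedBy_map_iff (fun w => ?_) (fun _ _ h => .rel _ _ (.inl (.inl h))) ?_
  · obtain a | a := w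
    · exact .refl _
    simp only [glueMap]
    split_ifs with h h'
    · exact h ▸ .symm _ _ (.rel _ _ (.inl (.inr ⟨rfl, rfl⟩)))
    · exact h' ▸ .symm _ _ (.rel _ _ (.inr ⟨rfl, rfl⟩))
    · exact .refl _
  · rintro _ _ ((⟨u, v, huv, rfl, rfl⟩ | ⟨rfl, rfl⟩) | ⟨rfl, rfl⟩)
    · exact .rel _ _ ⟨u, v, huv, rfl, rfl⟩
    · simp only [glueMap, if_true]
      exact .refl _
    · simp only [glueMap, if_true, if_neg P.source_ne_terminal.symm]
      exact .refl _

theorem connectedBy_series_iff (G : STGraph α β) (P : STGraph α' β') {T : Finset (β ⊕ β')} :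
    (G.series P).graph.ConnectedBy ⊥ T ↔ (G.graph.disjointUnion P.graph).ConnectedBy
      (glueRel ⊥ G.terminal P.source) T := by
  refine connectedBy_identify_iff.trans ?_
  have : glueRel ⊥ G.terminal P.source = pairRel (Sum.inl G.terminal) (Sum.inr P.source) := by
    ext u v
    simp [glueRel, Relation.Map]
  rw [this]

theorem connectedBy_series_pairRel_iff (G : STGraph α β) (P : STGraph α' β')
    {T : Finset (β ⊕ β')} :
    (G.series P).graph.ConnectedBy (pairRel (Sum.inl G.source) (Sum.inr P.terminal)) T ↔
      (G.graph.disjointUnion P.graph).ConnectedBy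
        (glueRel ⊥ G.terminal P.source ⊔ pairRel (Sum.inl G.source) (Sum.inr P.terminal)) T := by
  classical
  refine connectedBy_map_iff (fun w => ?_) (fun _ _ h => .rel _ _ (.inr h)) ?_
  · split_ifs with h
    · exact h ▸ .symm _ _ (.rel _ _ (.inl (.inr ⟨rfl, rfl⟩)))
    · exact .refl _
  · rintro _ _ ((⟨u, v, huv, rfl, rfl⟩ | ⟨rfl, rfl⟩) | ⟨rfl, rfl⟩)
    · exact huv.elim
    · simp only [if_true, reduceCtorEq, if_false]
      exact .refl _
    · simp only [reduceCtorEq, if_false, Sum.inr.injEq, if_neg P.source_ne_terminal.symm]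
      exact .rel _ _ ⟨rfl, rfl⟩

/-- The Kirchhoff polynomial of a graph with edge set `E`. -/
noncomputable def psi (G : STGraph α β) (E : Finset β) : MvPolynomial β ℚ :=
  treePoly E (G.graph.ConnectedBy ⊥)

/-- The Kirchhoff polynomial of a graph with edge set `E`, after the identification of source and
terminal. -/
noncomputable def phi (G : STGraph α β) (E : Finset β) : MvPolynomial β ℚ :=
  treePoly E (G.graph.ConnectedBy (pairRel G.source G.terminal))

theorem eqvGen_bot {x y : α} : EqvGen (⊥ : α → α → Prop) x y ↔ x = y :=
  ⟨fun h => by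
    have := (h.congr (fun w => x = w) fun _ _ h => h.elim).1 rfl
    exact this, fun h => h ▸ .refl _⟩

-- In a spanning tree of the glued graph exactly one part connects its two attaching vertices by
-- itself; the other part is a tree only after these vertices are identified.
open Classical in
theorem treePoly_glue {G : Graph α β} {P : STGraph α' β'} {x y : α} {r : α → α → Prop}
    (hx : x ∈ V(G)) (hy : y ∈ V(G)) (hxy : ¬ EqvGen r x y) (E : Finset β) (E' : Finset β') :
    treePoly (E.disjSum E') ((G.disjointUnion P.graph).ConnectedBy
        (glueRel r x P.source ⊔ pairRel (Sum.inl y) (Sum.inr P.terminal))) =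
      rename Sum.inl (treePoly E (G.ConnectedBy r)) * rename Sum.inr (P.phi E') +
        rename Sum.inl (treePoly E (G.ConnectedBy (r ⊔ pairRel x y))) *
          rename Sum.inr (P.psi E') := by
  rw [phi, psi, ← treePoly_disjSum_or]
  · exact treePoly_congr fun T _ =>
      connectedBy_glueRel_sup_iff hx hy P.source_mem P.terminal_mem
  · exact fun T h => h.mono le_sup_left
  · exact fun T h => h.mono bot_le
  · exact fun T h => h.exists_erase hx hy hxy
  · intro T h
    have := h.exists_erase P.source_mem P.terminal_mem
      (fun h => P.source_ne_terminal (eqvGen_bot.1 h))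
    rwa [bot_sup_eq] at this

/-- If `x` and `y` are already identified, the right part must be a tree of its own quotient, so
only one term survives. -/
theorem treePoly_glue_of_eqvGen {G : Graph α β} {P : STGraph α' β'} {x y : α} {r : α → α → Prop}
    (hx : x ∈ V(G)) (hy : y ∈ V(G)) (hxy : EqvGen r x y) (E : Finset β) (E' : Finset β') :
    treePoly (E.disjSum E') ((G.disjointUnion P.graph).ConnectedBy
        (glueRel r x P.source ⊔ pairRel (Sum.inl y) (Sum.inr P.terminal))) =
      rename Sum.inl (treePoly E (G.ConnectedBy r)) * rename Sum.inr (P.phi E') := by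
  rw [phi, ← treePoly_disjSum_and]
  refine treePoly_congr fun T _ => ?_
  rw [connectedBy_glueRel_sup_iff hx hy P.source_mem P.terminal_mem,
    ConnectedBy.sup_pairRel_iff (hxy.mono fun _ _ h => .inl h), or_iff_left_iff_imp]
  exact fun h => ⟨h.1, h.2.mono bot_le⟩

theorem map_bot_inl : Relation.Map (⊥ : α → α → Prop) Sum.inl Sum.inl =
    (⊥ : α ⊕ α' → α ⊕ α' → Prop) := by
  ext u v
  simp [Relation.Map]

theorem map_pairRel_inl (x y : α) : Relation.Map (pairRel x y) Sum.inl Sum.inl =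
    (pairRel (Sum.inl x) (Sum.inl y) : α ⊕ α' → α ⊕ α' → Prop) := by
  ext u v
  simp only [Relation.Map, pairRel]
  constructor
  · rintro ⟨_, _, ⟨rfl, rfl⟩, rfl, rfl⟩
    exact ⟨rfl, rfl⟩
  · rintro ⟨rfl, rfl⟩
    exact ⟨_, _, ⟨rfl, rfl⟩, rfl, rfl⟩

theorem psi_attach (G : STGraph α β) (P : STGraph α' β') {x y : α} (hx : x ∈ V(G.graph))
    (hy : y ∈ V(G.graph)) (hxy : x ≠ y) (E : Finset β) (E' : Finset β') :
    (G.attach P x y).psi (E.disjSum E') = rename Sum.inl (G.psi E) * rename Sum.inr (P.phi E') +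
      rename Sum.inl (treePoly E (G.graph.ConnectedBy (pairRel x y))) *
        rename Sum.inr (P.psi E') := by
  have h := treePoly_glue (P := P) hx hy (fun h => hxy (eqvGen_bot.1 h)) E E'
  rw [bot_sup_eq] at h
  rw [psi, psi, ← h, ← map_bot_inl]
  exact treePoly_congr fun T _ => connectedBy_attach_iff G P

/-- Only the coefficient of Φ of the attached graph matters later, so `w` stays unspecified. It is 0
when `x` and `y` are the source and terminal of `G`, in some order. -/
theorem phi_attach (G : STGraph α β) (P : STGraph α' β') {x y : α} (hx : x ∈ V(G.graph))
    (hy : y ∈ V(G.graph)) (E : Finset β) (E' : Finset β') :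
    ∃ w, (G.attach P x y).phi (E.disjSum E') = rename Sum.inl (G.phi E) * rename Sum.inr (P.phi E')
      + rename Sum.inl w * rename Sum.inr (P.psi E') := by
  have h : (G.attach P x y).phi (E.disjSum E') = _ :=
    (congrArg (fun r => treePoly _ ((G.attach P x y).graph.ConnectedBy r))
      (map_pairRel_inl G.source G.terminal).symm).trans
      (treePoly_congr fun T _ => connectedBy_attach_iff G P)
  rw [h]
  by_cases hxy : EqvGen (pairRel G.source G.terminal) x y
  · exact ⟨0, by rw [treePoly_glue_of_eqvGen hx hy hxy, phi.eq_1 G, map_zero, zero_mul, add_zero]⟩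
  · exact ⟨_, treePoly_glue hx hy hxy E E'⟩

theorem psi_parallel (G : STGraph α β) (P : STGraph α' β') (E : Finset β) (E' : Finset β') :
    (G.parallel P).psi (E.disjSum E') = rename Sum.inl (G.psi E) * rename Sum.inr (P.phi E') +
      rename Sum.inl (G.phi E) * rename Sum.inr (P.psi E') :=
  psi_attach G P G.source_mem G.terminal_mem G.source_ne_terminal E E'

theorem phi_parallel (G : STGraph α β) (P : STGraph α' β') (E : Finset β) (E' : Finset β') :
    (G.parallel P).phi (E.disjSum E') =
      rename Sum.inl (G.phi E) * rename Sum.inr (P.phi E') := by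
  rw [phi, phi, ← treePoly_glue_of_eqvGen G.source_mem G.terminal_mem (.rel _ _ ⟨rfl, rfl⟩)]
  exact (congrArg (fun r => treePoly _ ((G.parallel P).graph.ConnectedBy r))
      (map_pairRel_inl G.source G.terminal).symm).trans
      (treePoly_congr fun T _ => connectedBy_attach_iff G P)

theorem psi_series (G : STGraph α β) (P : STGraph α' β') (E : Finset β) (E' : Finset β') :
    (G.series P).psi (E.disjSum E') = rename Sum.inl (G.psi E) * rename Sum.inr (P.psi E') := by
  rw [psi, psi, psi, ← treePoly_disjSum_and]
  exact treePoly_congr fun T _ => (connectedBy_series_iff G P).trans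
    (connectedBy_glueRel_iff G.terminal_mem P.source_mem)

theorem connectedBy_pairRel_comm {G : Graph α β} {x y : α} {T : Finset β} :
    G.ConnectedBy (pairRel x y) T ↔ G.ConnectedBy (pairRel y x) T := by
  have key : ∀ x y, G.ConnectedBy (pairRel x y) T → G.ConnectedBy (pairRel y x) T := by
    refine fun x y h => h.bind rfl ?_
    rintro u v (⟨rfl, rfl⟩ | h)
    · exact .symm _ _ (.rel _ _ (.inl ⟨rfl, rfl⟩))
    · exact .rel _ _ (.inr h)
  exact ⟨key x y, key y x⟩

theorem phi_series (G : STGraph α β) (P : STGraph α' β') (E : Finset β) (E' : Finset β') :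
    (G.series P).phi (E.disjSum E') = rename Sum.inl (G.psi E) * rename Sum.inr (P.phi E') +
      rename Sum.inl (G.phi E) * rename Sum.inr (P.psi E') := by
  have h := treePoly_glue (P := P) (r := ⊥) G.terminal_mem G.source_mem
    (fun h => G.source_ne_terminal (eqvGen_bot.1 h).symm) E E'
  rw [bot_sup_eq] at h
  -- The gluing starts at the terminal of `G`, so the identified pair appears in reversed order.
  have h' : G.phi E = treePoly E (G.graph.ConnectedBy (pairRel G.terminal G.source)) :=
    treePoly_congr fun T _ => connectedBy_pairRel_comm
  rw [h', psi, ← h]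
  exact treePoly_congr fun T _ => connectedBy_series_pairRel_iff G P

theorem psi_K₂ : K₂.psi {()} = 1 := by
  have h0 : ¬ K₂.graph.ConnectedBy ⊥ ∅ := by
    intro h
    have := h.2 false (Or.inl rfl) true (Or.inr rfl)
    have h' := (this.congr (fun w => w = false) (by
      rintro u v (h | ⟨_, h, _⟩)
      · exact h.elim
      · simp at h)).1 rfl
    cases h'
  have h1 : K₂.graph.ConnectedBy ⊥ {()} := by
    have h : EqvGen (K₂.graph.linkRel ⊥ {()}) false true :=
      .rel _ _ (.inr ⟨(), by simp, Set.mem_univ _, .inl ⟨rfl, rfl⟩⟩)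
    refine ⟨⟨false, Or.inl rfl⟩, fun a _ b _ => ?_⟩
    cases a <;> cases b
    exacts [.refl _, h, h.symm, .refl _]
  rw [psi, treePoly_singleton, if_neg h0, if_pos h1]

theorem phi_K₂ : K₂.phi {()} = X () := by
  have h0 : K₂.graph.ConnectedBy (pairRel K₂.source K₂.terminal) ∅ := by
    have h : EqvGen (K₂.graph.linkRel (pairRel K₂.source K₂.terminal) ∅) false true :=
      .rel _ _ (.inl ⟨rfl, rfl⟩)
    refine ⟨⟨false, Or.inl rfl⟩, fun a _ b _ => ?_⟩
    cases a <;> cases b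
    exacts [.refl _, h, h.symm, .refl _]
  rw [phi, treePoly_singleton, if_pos h0]

theorem ConnectedBy.transfer {G : Graph α β} {G' : Graph α' β'} {r : α → α → Prop}
    {r' : α' → α' → Prop} {T : Finset β} {T' : Finset β'} (h : G.ConnectedBy r T) (F : α → α')
    (hF : Set.SurjOn F V(G) V(G')) (hF' : Set.MapsTo F V(G) V(G'))
    (hr : ∀ u v, r u v → r' (F u) (F v))
    (hl : ∀ e ∈ T, ∀ u v, G.IsLink e u v → ∃ e' ∈ T', G'.IsLink e' (F u) (F v)) :
    G'.ConnectedBy r' T' := by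
  obtain ⟨⟨a, ha⟩, h⟩ := h
  refine ⟨⟨F a, hF' ha⟩, fun b hb c hc => ?_⟩
  obtain ⟨b, hb', rfl⟩ := hF hb
  obtain ⟨c, hc', rfl⟩ := hF hc
  refine (h b hb' c hc').map_rel F ?_
  rintro u v (huv | ⟨e, he, huv⟩)
  · exact .rel _ _ (.inl (hr _ _ huv))
  · exact .rel _ _ (.inr (hl e he u v huv))

theorem connectedBy_of_equiv {G : STGraph α β} {G' : STGraph α' β'} {r : α → α → Prop}
    {r' : α' → α' → Prop} {T : Finset β} {T' : Finset β'}
    (f : V(G.graph) ≃ V(G'.graph)) (g : E(G.graph) ≃ E(G'.graph))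
    (hl : ∀ (e : E(G.graph)) (x y : V(G.graph)),
      G.graph.IsLink e x y ↔ G'.graph.IsLink (g e) (f x) (f y))
    (hT : ∀ e : E(G.graph), e.1 ∈ T → (g e).1 ∈ T')
    (hr : ∀ u v, r u v → ∃ hu hv, r' (f ⟨u, hu⟩) (f ⟨v, hv⟩))
    (h : G.graph.ConnectedBy r T) : G'.graph.ConnectedBy r' T' := by
  classical
  have hF : ∀ a (ha : a ∈ V(G.graph)),
      (if h : a ∈ V(G.graph) then (f ⟨a, h⟩).1 else G'.source) = f ⟨a, ha⟩ :=
    fun a ha => dif_pos ha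
  refine ConnectedBy.transfer h
    (fun a => if h : a ∈ V(G.graph) then (f ⟨a, h⟩).1 else G'.source) ?_ ?_ ?_ ?_
  · intro b hb
    refine ⟨(f.symm ⟨b, hb⟩).1, (f.symm ⟨b, hb⟩).2, ?_⟩
    simp
  · intro a ha
    beta_reduce
    rw [hF a ha]
    exact (f ⟨a, ha⟩).2
  · intro u v huv
    obtain ⟨hu, hv, h⟩ := hr u v huv
    rw [hF _ hu, hF _ hv]
    exact h
  · intro e he u v huv
    rw [hF _ huv.left_mem, hF _ huv.right_mem]
    exact ⟨_, hT ⟨e, huv.edge_mem⟩ he,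
      (hl ⟨e, huv.edge_mem⟩ ⟨u, huv.left_mem⟩ ⟨v, huv.right_mem⟩).1 huv⟩

/-- Isomorphic source-terminal graphs have the same polynomials, up to the names of the
variables. -/
theorem Isomorphic.exists_rename {G : STGraph α β} {G' : STGraph α' β'} (h : G.Isomorphic G')
    {E : Finset β} {E' : Finset β'} (hE : (E : Set β) = E(G.graph))
    (hE' : (E' : Set β') = E(G'.graph)) :
    ∃ (γ : Type v) (j : γ ↪ β) (j' : γ ↪ β') (p q : MvPolynomial γ ℚ),
      G.psi E = rename j p ∧ G.phi E = rename j q ∧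
        G'.psi E' = rename j' p ∧ G'.phi E' = rename j' q := by
  classical
  obtain ⟨f, g, hl, hs, ht⟩ := h
  have : Fintype E(G.graph) := hE ▸ inferInstanceAs (Fintype (E : Set β))
  let j : E(G.graph) ↪ β := Function.Embedding.subtype _
  let j' : E(G.graph) ↪ β' := g.toEmbedding.trans (Function.Embedding.subtype _)
  have hj : E = Finset.univ.map j := by
    ext e
    rw [← Finset.mem_coe, hE]
    simp [j]
  have hj' : E' = Finset.univ.map j' := by
    ext e
    rw [← Finset.mem_coe, hE']
    simp only [j', Finset.mem_map, Finset.mem_univ, true_and]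
    exact ⟨fun h => ⟨g.symm ⟨e, h⟩, by simp⟩, by rintro ⟨a, rfl⟩; exact (g a).2⟩
  have hT : ∀ (T : Finset E(G.graph)) (e : E(G.graph)), e.1 ∈ T.map j ↔ (g e).1 ∈ T.map j' := by
    intro T e
    exact (Finset.mem_map' j).trans (Finset.mem_map' j').symm
  have hl' : ∀ (e : E(G'.graph)) (x y : V(G'.graph)),
      G'.graph.IsLink e x y ↔ G.graph.IsLink (g.symm e) (f.symm x) (f.symm y) := by
    intro e x y
    rw [hl]
    simp
  have hT' : ∀ (T : Finset E(G.graph)) (e : E(G'.graph)), e.1 ∈ T.map j' →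
      (g.symm e).1 ∈ T.map j := by
    intro T e he
    rw [hT]
    simpa using he
  have hs' : f.symm ⟨G'.source, G'.source_mem⟩ = ⟨G.source, G.source_mem⟩ := by
    rw [← hs, f.symm_apply_apply]
  have ht' : f.symm ⟨G'.terminal, G'.terminal_mem⟩ = ⟨G.terminal, G.terminal_mem⟩ := by
    rw [← ht, f.symm_apply_apply]
  refine ⟨E(G.graph), j, j', treePoly Finset.univ fun T => G.graph.ConnectedBy ⊥ (T.map j),
    treePoly Finset.univ fun T => G.graph.ConnectedBy (pairRel G.source G.terminal) (T.map j),
    ?_, ?_, ?_, ?_⟩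
  · rw [hj, psi, treePoly_map]
  · rw [hj, phi, treePoly_map]
  · rw [hj', psi, treePoly_map]
    refine congrArg _ (treePoly_congr fun T _ => ⟨?_, ?_⟩)
    · exact connectedBy_of_equiv f.symm g.symm hl' (hT' T) fun _ _ h => h.elim
    · exact connectedBy_of_equiv f g hl (fun e => (hT T e).1) fun _ _ h => h.elim
  · rw [hj', phi, treePoly_map]
    refine congrArg _ (treePoly_congr fun T _ => ⟨?_, ?_⟩)
    · refine connectedBy_of_equiv f.symm g.symm hl' (hT' T) ?_
      rintro _ _ ⟨rfl, rfl⟩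
      exact ⟨G'.source_mem, G'.terminal_mem, by rw [hs'], by rw [ht']⟩
    · refine connectedBy_of_equiv f g hl (fun e => (hT T e).1) ?_
      rintro _ _ ⟨rfl, rfl⟩
      exact ⟨G.source_mem, G.terminal_mem, by rw [hs], by rw [ht]⟩

/-! ### Coprimality of Ψ and Φ for series-parallel graphs -/

/-- Two relatively prime polynomials that are positive at `(1, …, 1)`. -/
structure PosRelPrime {σ : Type*} (p q : MvPolynomial σ ℚ) : Prop where
  pos_left : 0 < eval (fun _ => 1) p
  pos_right : 0 < eval (fun _ => 1) q
  isRelPrime : IsRelPrime p q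

theorem ne_zero_of_eval_pos {σ : Type*} {p : MvPolynomial σ ℚ} (h : 0 < eval (fun _ => 1) p) :
    p ≠ 0 := by
  rintro rfl
  simp at h

theorem posRelPrime_rename_iff {σ τ : Type*} {f : σ → τ} (hf : Function.Injective f)
    {p q : MvPolynomial σ ℚ} : PosRelPrime (rename f p) (rename f q) ↔ PosRelPrime p q := by
  have h : ∀ r : MvPolynomial σ ℚ, eval (fun _ => 1) (rename f r) = eval (fun _ => 1) r :=
    fun r => by rw [eval_rename]; rfl
  constructor
  · rintro ⟨h1, h2, h3⟩
    rw [h] at h1 h2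
    exact ⟨h1, h2, (isRelPrime_rename_iff hf (ne_zero_of_eval_pos h1)).1 h3⟩
  · rintro ⟨h1, h2, h3⟩
    exact ⟨by rwa [h], by rwa [h], (isRelPrime_rename_iff hf (ne_zero_of_eval_pos h1)).2 h3⟩

theorem PosRelPrime.symm {σ : Type*} {p q : MvPolynomial σ ℚ} (h : PosRelPrime p q) :
    PosRelPrime q p :=
  ⟨h.2, h.1, h.3.symm⟩

/-- A common divisor with `p` must divide `q p'`, and `p` is prime to both factors; symmetrically
for `p'`. Positivity, unlike nonvanishing, passes to the sum. -/
theorem PosRelPrime.combine {σ τ : Type*} {p q : MvPolynomial σ ℚ} {p' q' : MvPolynomial τ ℚ}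
    (h : PosRelPrime p q) (h' : PosRelPrime p' q') :
    PosRelPrime (rename Sum.inl p * rename Sum.inr p' : MvPolynomial (σ ⊕ τ) ℚ)
      (rename Sum.inl p * rename Sum.inr q' + rename Sum.inl q * rename Sum.inr p') := by
  obtain ⟨h1, h2, h3⟩ := (posRelPrime_rename_iff (τ := σ ⊕ τ) Sum.inl_injective).2 h
  obtain ⟨h1', h2', h3'⟩ := (posRelPrime_rename_iff (τ := σ ⊕ τ) Sum.inr_injective).2 h'
  have hpp : IsRelPrime (rename Sum.inl p : MvPolynomial (σ ⊕ τ) ℚ) (rename Sum.inr p') :=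
    isRelPrime_rename_rename (by simp) (ne_zero_of_eval_pos h1) (ne_zero_of_eval_pos h1')
  refine ⟨?_, ?_, IsRelPrime.mul_left ?_ ?_⟩
  · rw [map_mul]; positivity
  · rw [map_add, map_mul, map_mul]; positivity
  · intro d hd hd'
    refine (h3.mul_right hpp) hd ?_
    exact (dvd_add_right (hd.mul_right _)).1 hd'
  · intro d hd hd'
    refine (hpp.symm.mul_right h3') hd ?_
    exact (dvd_add_left (hd.mul_left _)).1 hd'

theorem IsSeriesParallel.posRelPrime {α : Type u} {β : Type v} {G : STGraph α β}
    (h : G.IsSeriesParallel) :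
    ∀ E : Finset β, (E : Set β) = E(G.graph) → PosRelPrime (G.psi E) (G.phi E) := by
  induction h with
  | single G h =>
    intro E hE
    obtain ⟨γ, j, j', p, q, h1, h2, h3, h4⟩ := h.exists_rename hE
      (E' := {()}) (by ext; simp [K₂])
    rw [h1, h2, posRelPrime_rename_iff j.injective, ← posRelPrime_rename_iff j'.injective,
      ← h3, ← h4, psi_K₂, phi_K₂]
    exact ⟨by simp, by simp, isRelPrime_one_left⟩
  | @parallel α α' β β' G G' _ _ ih ih' =>
    intro E hE
    have hE : E.toLeft.disjSum E.toRight = E ∧ (E.toLeft : Set β) = E(G.graph) ∧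
        (E.toRight : Set β') = E(G'.graph) := by
      refine ⟨Finset.toLeft_disjSum_toRight, ?_, ?_⟩ <;> ext e <;>
        simp [← Finset.mem_coe (s := E), hE, STGraph.parallel, attach, disjointUnion]
    rw [← hE.1, psi_parallel, phi_parallel, add_comm]
    -- Parallel joins obey the series formulas with Ψ and Φ exchanged.
    have := (ih _ hE.2.1).symm.combine (ih' _ hE.2.2).symm
    exact this.symm
  | @series α α' β β' G G' _ _ ih ih' =>
    intro E hE
    have hE : E.toLeft.disjSum E.toRight = E ∧ (E.toLeft : Set β) = E(G.graph) ∧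
        (E.toRight : Set β') = E(G'.graph) := by
      refine ⟨Finset.toLeft_disjSum_toRight, ?_, ?_⟩ <;> ext e <;>
        simp [← Finset.mem_coe (s := E), hE, STGraph.series, identify, disjointUnion]
    rw [← hE.1, psi_series, phi_series]
    exact (ih _ hE.2.1).combine (ih' _ hE.2.2)
  | @ofIso _ _ _ β' G G' _ hiso ih =>
    intro E' hE'
    have hfin : E(G.graph).Finite := by
      obtain ⟨-, g, -⟩ := hiso
      have : Finite E(G'.graph) := hE' ▸ inferInstanceAs (Finite (E' : Set β'))
      exact Set.finite_coe_iff.1 (Finite.of_equiv _ g.symm)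
    obtain ⟨γ, j, j', p, q, h1, h2, h3, h4⟩ := hiso.exists_rename (E := hfin.toFinset)
      (by simp) hE'
    have := ih hfin.toFinset (by simp)
    rw [h1, h2, posRelPrime_rename_iff j.injective] at this
    rwa [h3, h4, posRelPrime_rename_iff j'.injective]

/-! ### Splitting one relation into two -/

theorem exists_combination {ι κ : Type*} [Fintype ι] [Fintype κ] {p q : MvPolynomial ι ℚ}
    (hpq : PosRelPrime p q) {g : MvPolynomial κ ℚ} {P Q g' Ψ Φ S Y Z : MvPolynomial (ι ⊕ κ) ℚ}
    (hP : P = rename Sum.inl p) (hQ : Q = rename Sum.inl q) (hg : g' = rename Sum.inr g)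
    (hΨ : Ψ = P * S + Y * g') (hΦ : Φ = Q * S + Z * g')
    (A : ι ⊕ κ → MvPolynomial (ι ⊕ κ) ℚ)
    (h : Q * Ψ + P * Φ = ∑ j, A j * (Q * pderiv j (P * g') + P * pderiv j (Q * g'))) :
    ∃ B C, Ψ = ∑ j, A j * pderiv j (P * g') + B * (P * g') ∧
      Φ = ∑ j, A j * pderiv j (Q * g') + C * (Q * g') := by
  obtain ⟨hP0, hQ0, hPQ⟩ := (posRelPrime_rename_iff (τ := ι ⊕ κ) Sum.inl_injective).2 hpq
  rw [← hP] at hP0 hPQ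
  rw [← hQ] at hQ0 hPQ
  have hP0 := ne_zero_of_eval_pos hP0
  have hQ0 := ne_zero_of_eval_pos hQ0
  set D : MvPolynomial (ι ⊕ κ) ℚ → MvPolynomial (ι ⊕ κ) ℚ := fun f => ∑ j, A j * pderiv j f
    with hD
  have hmul : ∀ a b, D (a * b) = D a * b + a * D b := by
    intro a b
    simp only [hD, pderiv_mul, Finset.sum_mul, Finset.mul_sum, ← Finset.sum_add_distrib]
    exact Finset.sum_congr rfl fun j _ => by ring
  have h' : Q * Ψ + P * Φ = Q * D (P * g') + P * D (Q * g') := by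
    rw [h]
    simp only [hD, Finset.mul_sum, ← Finset.sum_add_distrib]
    exact Finset.sum_congr rfl fun j _ => by ring
  change ∃ B C, Ψ = D (P * g') + B * (P * g') ∧ Φ = D (Q * g') + C * (Q * g')
  rw [hmul, hmul] at h' ⊢
  rw [hΨ, hΦ] at h' ⊢
  obtain ⟨k, hk⟩ : g' ∣ S - D g' := by
    have hdvd : g' ∣ (P * Q) * (S - D g') := by
      -- Expanding `h'` by the Leibniz rule, `P * Q * (S - D g')` appears twice, whence the factor
      -- 1/2.
      refine ⟨C (1 / 2) * (Q * D P + P * D Q - Q * Y - P * Z), ?_⟩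
      have h2 : (C (1 / 2) : MvPolynomial (ι ⊕ κ) ℚ) * 2 = 1 := by
        rw [← map_ofNat (C : ℚ →+* MvPolynomial (ι ⊕ κ) ℚ) 2, ← C_mul]
        norm_num
      linear_combination C (1 / 2) * h' - P * Q * (S - D g') * h2
    by_cases hg0 : g' = 0
    · have hdvd : P * Q * (S - D g') = 0 := by
        obtain ⟨c, hc⟩ := hdvd
        rw [hc, hg0, zero_mul]
      rw [(mul_eq_zero.1 hdvd).resolve_left (mul_ne_zero hP0 hQ0)]
      exact dvd_zero _
    · refine IsRelPrime.dvd_of_dvd_mul_left ?_ hdvd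
      rw [hP, hQ, ← map_mul, hg]
      refine isRelPrime_rename_rename (by simp) (by rwa [← hg]) ?_
      rw [map_mul, ← hP, ← hQ]
      exact mul_ne_zero hP0 hQ0
  -- If `g'` vanishes, as for disconnected `Γ`, it cannot be cancelled, but then `S = D g'` and zero
  -- multipliers suffice.
  by_cases hg0 : g' = 0
  · refine ⟨0, 0, ?_, ?_⟩
    · linear_combination P * hk + (Y - D P + P * k) * hg0
    · linear_combination Q * hk + (Z - D Q + Q * k) * hg0
  have h3 : Q * (P * k + Y - D P) + P * (Q * k + Z - D Q) = 0 := by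
    refine (mul_eq_zero.1 (?_ : g' * _ = 0)).resolve_left hg0
    linear_combination h' - 2 * P * Q * hk
  obtain ⟨B, hB⟩ : P ∣ P * k + Y - D P :=
    hPQ.dvd_of_dvd_mul_left ⟨-(Q * k + Z - D Q), by linear_combination h3⟩
  obtain ⟨C, hC⟩ : Q ∣ Q * k + Z - D Q :=
    hPQ.symm.dvd_of_dvd_mul_left ⟨-(P * k + Y - D P), by linear_combination h3⟩
  exact ⟨B, C, by linear_combination P * hk + g' * hB, by linear_combination Q * hk + g' * hC⟩

theorem kirchhoff_eq_psi [Fintype β] (G : STGraph α β) {E : Finset β}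
    (hE : (E : Set β) = E(G.graph)) : G.kirchhoff = G.psi E :=
  kirchhoff_eq_treePoly _ hE

theorem kirchhoffST_eq_phi [Fintype β] (G : STGraph α β) {E : Finset β}
    (hE : (E : Set β) = E(G.graph)) : G.kirchhoffST = G.phi E :=
  kirchhoff_identify_eq_treePoly _ hE _ _

theorem coe_disjSum_eq_edgeSet_attach {G : STGraph α β} {P : STGraph α' β'} {x y : α}
    {E : Finset β} {E' : Finset β'} (hE : (E : Set β) = E(G.graph))
    (hE' : (E' : Set β') = E(P.graph)) :
    ((E.disjSum E' : Finset (β ⊕ β')) : Set (β ⊕ β')) = E((G.attach P x y).graph) := by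
  ext (e | e) <;> simp [attach, disjointUnion, ← hE, ← hE']

theorem coe_disjSum_eq_edgeSet_series {G : STGraph α β} {P : STGraph α' β'}
    {E : Finset β} {E' : Finset β'} (hE : (E : Set β) = E(G.graph))
    (hE' : (E' : Set β') = E(P.graph)) :
    ((E.disjSum E' : Finset (β ⊕ β')) : Set (β ⊕ β')) = E((G.series P).graph) := by
  ext (e | e) <;> simp [series, identify, disjointUnion, ← hE, ← hE']

/-- Condition 1 for an edge of the parallel join of `G` and `H`, with the variables of `H`
identified with the corresponding variables of `G`. -/
theorem exists_of_conditionOne {ι κ : Type*} [Fintype ι] [Fintype κ] {p q : MvPolynomial ι ℚ}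
    {g : MvPolynomial κ ℚ} {P Q g' Ψ Φ : MvPolynomial (ι ⊕ κ) ℚ}
    (hP : P = rename Sum.inl p) (hQ : Q = rename Sum.inl q) (hg : g' = rename Sum.inr g)
    {K : MvPolynomial ((ι ⊕ κ) ⊕ ι) ℚ}
    (hK : K = rename Sum.inl Ψ * rename Sum.inr q + rename Sum.inl Φ * rename Sum.inr p)
    {e : ι ⊕ κ} (hΨ : pderiv e Ψ = P * g') (hΦ : pderiv e Φ = Q * g')
    (h : K ∈ Ideal.span (Set.range fun j => pderiv j (pderiv (Sum.inl e) K))) :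
    ∃ A : ι ⊕ κ → MvPolynomial (ι ⊕ κ) ℚ,
      Q * Ψ + P * Φ = ∑ j, A j * (Q * pderiv j (P * g') + P * pderiv j (Q * g')) := by
  obtain ⟨c, hc⟩ := Ideal.mem_span_range_iff_exists_fun.1 h
  let S : MvPolynomial ((ι ⊕ κ) ⊕ ι) ℚ →ₐ[ℚ] MvPolynomial (ι ⊕ κ) ℚ :=
    rename (Sum.elim id Sum.inl)
  have hSl : ∀ f, S (rename Sum.inl f) = f := fun f => by
    rw [rename_rename, Sum.elim_comp_inl, rename_id_apply]
  have hSr : ∀ f, S (rename Sum.inr f) = rename Sum.inl f := fun f => by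
    rw [rename_rename, Sum.elim_comp_inr]
  have hll : ∀ (j : ι ⊕ κ) (f : MvPolynomial (ι ⊕ κ) ℚ),
      pderiv (Sum.inl j : (ι ⊕ κ) ⊕ ι) (rename Sum.inl f) = rename Sum.inl (pderiv j f) :=
    fun j f => pderiv_rename Sum.inl_injective j f
  have hrr : ∀ (j : ι) (f : MvPolynomial ι ℚ),
      pderiv (Sum.inr j : (ι ⊕ κ) ⊕ ι) (rename Sum.inr f) = rename Sum.inr (pderiv j f) :=
    fun j f => pderiv_rename Sum.inr_injective j f
  have hlr : ∀ (j : ι ⊕ κ) (f : MvPolynomial ι ℚ),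
      pderiv (Sum.inl j : (ι ⊕ κ) ⊕ ι) (rename Sum.inr f) = 0 :=
    fun j f => pderiv_rename_eq_zero (by simp) f
  have hrl : ∀ (j : ι) (f : MvPolynomial (ι ⊕ κ) ℚ),
      pderiv (Sum.inr j : (ι ⊕ κ) ⊕ ι) (rename Sum.inl f) = 0 :=
    fun j f => pderiv_rename_eq_zero (by simp) f
  have hg0 : ∀ i : ι, pderiv (Sum.inl i : ι ⊕ κ) g' = 0 := fun i => by
    rw [hg]
    exact pderiv_rename_eq_zero (by simp) g
  have hP' : ∀ i : ι, pderiv (Sum.inl i : ι ⊕ κ) P = rename Sum.inl (pderiv i p) := fun i => by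
    rw [hP, pderiv_rename Sum.inl_injective]
  have hQ' : ∀ i : ι, pderiv (Sum.inl i : ι ⊕ κ) Q = rename Sum.inl (pderiv i q) := fun i => by
    rw [hQ, pderiv_rename Sum.inl_injective]
  have hKe : pderiv (Sum.inl e) K = rename Sum.inl (P * g') * rename Sum.inr q +
      rename Sum.inl (Q * g') * rename Sum.inr p := by
    rw [hK, map_add, pderiv_mul, pderiv_mul, hll, hll, hlr, hlr, hΨ, hΦ, mul_zero, mul_zero,
      add_zero, add_zero]
  have hKl : ∀ j, S (pderiv (Sum.inl j) (pderiv (Sum.inl e) K)) =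
      Q * pderiv j (P * g') + P * pderiv j (Q * g') := by
    intro j
    rw [hKe, map_add, pderiv_mul, pderiv_mul, hll, hll, hlr, hlr, mul_zero, mul_zero,
      add_zero, add_zero, map_add, map_mul S, map_mul S, hSl, hSl, hSr, hSr, ← hP, ← hQ]
    ring
  -- After the substitution the copied variable gives the same expression as the original one,
  -- because `g'` is constant in the variables of `H`.
  have hKr : ∀ i, S (pderiv (Sum.inr i) (pderiv (Sum.inl e) K)) =
      Q * pderiv (Sum.inl i) (P * g') + P * pderiv (Sum.inl i) (Q * g') := by
    intro i
    rw [hKe, map_add, pderiv_mul, pderiv_mul, hrl, hrl, hrr, hrr, zero_mul, zero_mul,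
      zero_add, zero_add, map_add, map_mul S, map_mul S, hSl, hSl, hSr, hSr, ← hP', ← hQ',
      pderiv_mul, pderiv_mul, hg0]
    ring
  -- The coefficients of a variable and of its copy add up; the variables in `κ` have no copy and
  -- receive 0.
  refine ⟨fun j => S (c (Sum.inl j)) + Sum.elim (fun i => S (c (Sum.inr i))) 0 j, ?_⟩
  have h1 := congrArg S hc
  rw [map_sum, Fintype.sum_sum_type] at h1
  simp only [map_mul, hKl, hKr] at h1
  rw [hK, map_add, map_mul S, map_mul S, hSl, hSl, hSr, hSr, ← hP, ← hQ] at h1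
  simp only [add_mul, Finset.sum_add_distrib]
  rw [Fintype.sum_sum_type (f := fun j => Sum.elim (fun i => S (c (Sum.inr i))) 0 j * _)]
  simp only [Sum.elim_inl, Sum.elim_inr, Pi.zero_apply, zero_mul, Finset.sum_const_zero, add_zero]
  rw [h1]
  ring

end STGraph

/-! ### The proposition -/

theorem mainTheorem6 {α α' : Type u} {β β' : Type v} [Fintype β] [Fintype β']
    (H : STGraph α β) (Γ : STGraph α' β') (x y : α)
    (hx : x ∈ V(H.graph)) (hy : y ∈ V(H.graph)) (hxy : x ≠ y)
    (hH : H.IsSeriesParallel) (hG : (H.insertEar Γ x y).IsSeriesParallel)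
    (h1 : ((H.insertEar Γ x y).parallel H).graph.ConditionOne (Sum.inl STGraph.earEdge)) :
    (H.insertEar Γ x y).SimultaneousCombination STGraph.earEdge := by
  classical
  have hE : ((Finset.univ.filter (· ∈ E(H.graph)) : Finset β) : Set β) = E(H.graph) := by simp
  have hE' : ((Finset.univ.filter (· ∈ E(Γ.graph)) : Finset β') : Set β') = E(Γ.graph) := by simp
  generalize (Finset.univ.filter (· ∈ E(H.graph)) : Finset β) = E at hE
  generalize (Finset.univ.filter (· ∈ E(Γ.graph)) : Finset β') = E' at hE'
  have hEs := STGraph.coe_disjSum_eq_edgeSet_series hE'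
    (show ((({()} : Finset Unit)) : Set Unit) = E(STGraph.K₂.graph) by ext; simp [STGraph.K₂])
  have hEG : _ = E((H.insertEar Γ x y).graph) :=
    STGraph.coe_disjSum_eq_edgeSet_attach (x := x) (y := y) hE hEs
  have hEP : _ = E(((H.insertEar Γ x y).parallel H).graph) :=
    STGraph.coe_disjSum_eq_edgeSet_attach hEG hE
  have hpsi : (Γ.series STGraph.K₂).psi (E'.disjSum {()}) = rename Sum.inl (Γ.psi E') := by
    rw [STGraph.psi_series, STGraph.psi_K₂, map_one, mul_one]
  have hphi : (Γ.series STGraph.K₂).phi (E'.disjSum {()}) =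
      rename Sum.inl (Γ.psi E') * X (Sum.inr ()) + rename Sum.inl (Γ.phi E') := by
    rw [STGraph.phi_series, STGraph.psi_K₂, STGraph.phi_K₂, map_one, mul_one, rename_X]
  have hΨ := STGraph.psi_attach H (Γ.series STGraph.K₂) hx hy hxy E (E'.disjSum {()})
  obtain ⟨w, hΦ⟩ := STGraph.phi_attach H (Γ.series STGraph.K₂) hx hy E (E'.disjSum {()})
  -- The variable of `e` enters only through Φ of the ear, linearly and with coefficient Ψ of `Γ`.
  -- Stated for arbitrary `a` and `b`, this serves both Ψ and Φ of the whole graph.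
  have hd : ∀ a b : MvPolynomial β ℚ, pderiv STGraph.earEdge
      (rename Sum.inl a * rename Sum.inr ((Γ.series STGraph.K₂).phi (E'.disjSum {()})) +
        rename Sum.inl b * rename Sum.inr ((Γ.series STGraph.K₂).psi (E'.disjSum {()})) :
          MvPolynomial (β ⊕ (β' ⊕ Unit)) ℚ) =
      rename Sum.inl a * rename Sum.inr (rename Sum.inl (Γ.psi E')) := by
    intro a b
    have h0 : ∀ f : MvPolynomial β ℚ,
        pderiv (STGraph.earEdge : β ⊕ (β' ⊕ Unit)) (rename Sum.inl f) = 0 :=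
      fun f => pderiv_rename_eq_zero (by simp [STGraph.earEdge]) f
    have h1 : ∀ f : MvPolynomial β' ℚ,
        pderiv (Sum.inr () : β' ⊕ Unit) (rename Sum.inl f) = 0 :=
      fun f => pderiv_rename_eq_zero (by simp) f
    rw [map_add, pderiv_mul, pderiv_mul, h0, h0, STGraph.earEdge,
      pderiv_rename Sum.inr_injective, pderiv_rename Sum.inr_injective, hpsi, hphi,
      map_add (pderiv (Sum.inr () : β' ⊕ Unit)), pderiv_mul, pderiv_X_self, h1, h1]
    simp
  have hΨe := hd (H.psi E) (treePoly E (H.graph.ConnectedBy (pairRel x y)))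
  rw [← hΨ] at hΨe
  have hΦe := hd (H.phi E) w
  rw [← hΦ] at hΦe
  rw [hpsi] at hΨ hΦ
  have hear : (Sum.inl STGraph.earEdge : (β ⊕ (β' ⊕ Unit)) ⊕ β) ∈
      E(((H.insertEar Γ x y).parallel H).graph) := by
    rw [← hEP]
    simp [STGraph.earEdge]
  rw [Graph.ConditionOne, Graph.kirchhoff_deleteEdges _ hear, Graph.kirchhoff_eq_treePoly _ hEP]
    at h1
  obtain ⟨A, hA⟩ := STGraph.exists_of_conditionOne rfl rfl rfl
    (STGraph.psi_parallel (H.insertEar Γ x y) H _ E) hΨe hΦe h1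
  obtain ⟨B, C, hB, hC⟩ := STGraph.exists_combination (hH.posRelPrime E hE) rfl rfl rfl hΨ hΦ A hA
  refine ⟨A, B, C, ?_, ?_⟩
  · rw [STGraph.kirchhoff_eq_psi _ hEG]
    refine hB.trans ?_
    rw [← hΨe]
    rfl
  · rw [STGraph.kirchhoffST_eq_phi _ hEG]
    refine hC.trans ?_
    rw [← hΦe]
    rfl
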